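/- **Theorem 3.1.** Let $n\ge 2$, let $0<\alpha\le 1$, and let $f\in C^{\alpha}(\mathbb S^n)$ (that is, $f$ is $\alpha$-Hölder continuous on the unit sphere $\mathbb S^n\subset\mathbb R^{n+1}$) be positive. Extend $f$ to $\mathbb R^{n+1}\setminus\{0\}$ homogeneously of degree $-1$, $f(y)=|y|^{-1}f(y/|y|)$, and let $\omega_n=|\mathbb S^n|$ be the area of the unit sphere. Then for all $x,\xi\in\mathbb S^n$ with $\xi\perp x$ the integral $$I_f(x,\xi)=\int_{\mathbb R^{n+1}}\frac{|x-y|^2-(n+1)\langle\xi,y\rangle^2}{|x-y|^{n+3}}\Big(f(y)-\frac{f(x)}{|y|}\Big)\,dy$$ converges absolutely. Moreover, for every solution $u\in C^2(\mathbb S^n)$ of $$\Delta_{\mathbb S^n}u+nu=f\quad\text{on }\mathbb S^n,$$ the following are equivalent: 1. $u$ is convex, i.e. its extension to $\mathbb R^{n+1}$ homogeneous of degree $1$, $y\mapsto |y|\,u(y/|y|)$ (with value $0$ at the origin), is a convex function; 2. $\nabla^2u+u\,I\ge 0$ on $\mathbb S^n$, where $\nabla^2u$ is the covariant Hessian of $u$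 on $\mathbb S^n$ and $I$ the identity on the tangent spaces; 3. for all $x,\xi\in\mathbb S^n$ with $\xi\perp x$, $$\frac1{\omega_n}\,I_f(x,\xi)+\frac1n f(x)\ \ge\ 0 .$$ -/

import Mathlib

open MeasureTheory Set Metric
open scoped RealInnerProductSpace NNReal Manifold ContDiff

/-- The ambient Euclidean space of dimension `n + 1`. -/
abbrev Ambient (n : ℕ) : Type := EuclideanSpace ℝ (Fin (n + 1))

/-- The round unit sphere of dimension `n`. -/
abbrev UnitSphere (n : ℕ) : Type := sphere (0 : Ambient n) 1

/-- The radial projection `y ↦ y / |y|` of a non-zero vector to the unit sphere. -/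
noncomputable def radialProj {n : ℕ} (y : Ambient n) (hy : y ≠ 0) : UnitSphere n :=
  ⟨‖y‖⁻¹ • y, by
    rw [mem_sphere_zero_iff_norm, norm_smul, norm_inv, norm_norm,
      inv_mul_cancel₀ (norm_ne_zero_iff.mpr hy)]⟩

open Classical in
/-- The extension of a function `g` on the unit sphere to the ambient space that is homogeneous of
degree `k`: it maps `y ≠ 0` to `|y| ^ k * g (y / |y|)`. Its value at the origin is set to `0`. -/
noncomputable def homExt {n : ℕ} (k : ℤ) (g : UnitSphere n → ℝ) (y : Ambient n) : ℝ :=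
  if hy : y = 0 then 0 else ‖y‖ ^ k * g (radialProj y hy)

/-- The covariant Hessian of `u` at `x` on the round sphere, for tangent vectors `ξ, η ⟂ x`.
It is the second derivative at `x` of the extension of `u` that is constant along rays: as the
radial derivative of that extension vanishes, the second fundamental form contributes nothing. -/
noncomputable def sphereHessian {n : ℕ} (u : UnitSphere n → ℝ) (x : UnitSphere n)
    (ξ η : Ambient n) : ℝ :=
  iteratedFDeriv ℝ 2 (homExt 0 u) (x : Ambient n) ![ξ, η]

/-- The Laplace-Beltrami operator of the round sphere: the Euclidean Laplacian, on the sphere, of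
the extension of `u` that is constant along rays (the trace of the covariant Hessian). -/
noncomputable def sphereLaplacian {n : ℕ} (u : UnitSphere n → ℝ) (x : UnitSphere n) : ℝ :=
  Laplacian.laplacian (homExt 0 u) (x : Ambient n)

/-- `u` is a classical (twice continuously differentiable) solution of `Δ u + n u = f` on the
unit sphere. -/
def IsSphereSolution {n : ℕ} (f u : UnitSphere n → ℝ) : Prop :=
  ContMDiff (𝓡 n) 𝓘(ℝ, ℝ) 2 u ∧ ∀ x, sphereLaplacian u x + n * u x = f x

/-- A function on the sphere is convex, in the sense of support functions, if its extension
homogeneous of degree one is a convex function on the ambient space. -/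
def IsConvexOnSphere {n : ℕ} (u : UnitSphere n → ℝ) : Prop :=
  ConvexOn ℝ univ (homExt 1 u)

/-- The symmetric form `∇² u + u I` is positive semidefinite on every tangent space. -/
def HessianFormNonneg {n : ℕ} (u : UnitSphere n → ℝ) : Prop :=
  ∀ (x : UnitSphere n) (ξ : Ambient n), ⟪(x : Ambient n), ξ⟫ = 0 →
    0 ≤ sphereHessian u x ξ ξ + u x * ‖ξ‖ ^ 2

/-- The area `|S^n|` of the unit sphere. -/
noncomputable def sphereArea (n : ℕ) : ℝ :=
  (volume : Measure (Ambient n)).toSphere.real univ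

/-- The integrand of the criterion. -/
noncomputable def criterionIntegrand {n : ℕ} (f : UnitSphere n → ℝ) (x ξ : UnitSphere n)
    (y : Ambient n) : ℝ :=
  (‖(x : Ambient n) - y‖ ^ 2 - (n + 1) * ⟪(ξ : Ambient n), y⟫ ^ 2)
      / ‖(x : Ambient n) - y‖ ^ (n + 3)
    * (homExt (-1) f y - f x / ‖y‖)

/-!
The extension `U = homExt 1 u` of a solution is `C²` off the origin and homogeneous of degree one, and
its Euclidean Laplacian is the extension of `f` of degree `-1` (`sum_hessian_homExt_one_eq_homExt`).
On the unit sphere the Hessian of `U` is `∇² u + u I` on tangent vectors and annihilates the radial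
direction, so that `U` is convex if and only if `∇² u + u I ≥ 0`. Lines through the origin, where `U` is
not differentiable, are reached as limits (`isConvexOnSphere_iff_hessianFormNonneg`).

The integral criterion follows from the identity `∇² u (ξ, ξ) + u = I_f / ω + f / n` at `x` for unit
vectors `ξ ⟂ x` (`sphereHessian_add_eq`). Replacing `u` by `u - f x / n` turns the right-hand side into
`f - f x`, which vanishes at `x`. It remains to represent `∂_ξξ U (x)` as the integral of `Δ U` against
the second derivative `∂_ξξ Γ (x - y)` of the Newtonian potential (`hessian_eq_integral`). To this end
`Γ` is replaced by a multiple of `(|z| ^ 2 + ε ^ 2) ^ ((2 - N) / 2)`, with `N = n + 1`. As third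
derivatives are symmetric, integration by parts gives

  `∫ ∂_ξξ U · Δ Γ_ε = ∫ Δ U · ∂_ξξ Γ_ε`.

On the left `Δ Γ_ε` is an approximate identity with an explicit mass, and the left-hand side tends to
`∂_ξξ U (x)`. On the right the Hölder bound on `f - f x` gives an integrable majorant near `x`; the
homogeneity of `U` gives one near the origin and at infinity.
-/

/-! ### Cutoffs at the origin and at infinity -/

section Cutoff

variable {E : Type*} [NormedAddCommGroup E]

/-- A smooth cutoff with values in `[0, 1]` that vanishes to second order at the origin, decays like
`|y| ^ (-2)` at infinity, and tends to `1` away from the origin as `δ → 0`. Being a rational function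
of `|y| ^ 2`, it has explicit derivatives. -/
noncomputable def originCutoff (δ : ℝ) (y : E) : ℝ :=
  ‖y‖ ^ 2 / ((‖y‖ ^ 2 + δ) * (1 + δ * ‖y‖ ^ 2))

theorem originCutoff_nonneg {δ : ℝ} (hδ : 0 < δ) (y : E) : 0 ≤ originCutoff δ y := by
  unfold originCutoff; positivity

theorem originCutoff_le_one {δ : ℝ} (hδ : 0 < δ) (y : E) : originCutoff δ y ≤ 1 := by
  unfold originCutoff
  refine div_le_one_of_le₀ ?_ (by positivity)
  have : 0 ≤ ‖y‖ ^ 2 := by positivity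
  nlinarith [mul_nonneg hδ.le this, mul_nonneg (mul_nonneg hδ.le this) this, sq_nonneg δ]

theorem continuous_originCutoff {δ : ℝ} (hδ : 0 < δ) : Continuous (originCutoff (E := E) δ) := by
  unfold originCutoff
  exact (by fun_prop : Continuous fun y : E ↦ ‖y‖ ^ 2).div (by fun_prop) fun y ↦ by positivity

variable [InnerProductSpace ℝ E]

theorem hasLineDerivAt_originCutoff {δ : ℝ} (hδ : 0 < δ) (y a : E) :
    HasLineDerivAt ℝ (originCutoff δ) (2 * ⟪y, a⟫ * (δ * (1 - (‖y‖ ^ 2) ^ 2)) /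
      ((‖y‖ ^ 2 + δ) * (1 + δ * ‖y‖ ^ 2)) ^ 2) y a := by
  have hp : HasDerivAt (fun t : ℝ ↦ ‖y + t • a‖ ^ 2) (2 * ⟪y, a⟫) 0 := by
    have h : HasDerivAt (fun t : ℝ ↦ y + t • a) ((1 : ℝ) • a) 0 :=
      ((hasDerivAt_id (0 : ℝ)).smul_const a).const_add y
    simpa using h.norm_sq
  have h0 : (‖y‖ ^ 2 + δ) * (1 + δ * ‖y‖ ^ 2) ≠ 0 := by positivity
  unfold HasLineDerivAt originCutoff
  convert! hp.div ((hp.add_const δ).mul ((hp.const_mul δ).const_add 1)) (by simpa using h0) using 1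
  simp only [zero_smul, add_zero]
  congr 1
  · simp only [Pi.mul_apply, zero_smul, add_zero]
    ring
  · simp

/-- The derivative of the cutoff is bounded by a multiple of `|y|⁻¹` that does not depend on `δ`. -/
theorem abs_deriv_originCutoff_le {δ : ℝ} (hδ : 0 < δ) (y a : E) :
    |2 * ⟪y, a⟫ * (δ * (1 - (‖y‖ ^ 2) ^ 2)) / ((‖y‖ ^ 2 + δ) * (1 + δ * ‖y‖ ^ 2)) ^ 2|
      ≤ 2 * ‖a‖ * ‖y‖⁻¹ := by
  rcases eq_or_ne y 0 with rfl | hy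
  · simp
  have hy : 0 < ‖y‖ := norm_pos_iff.2 hy
  set p := ‖y‖ ^ 2 with hp
  have hp0 : 0 < p := by positivity
  have h0 : 0 < (p + δ) * (1 + δ * p) := by positivity
  rw [abs_div, abs_of_pos (pow_pos h0 2), div_le_iff₀ (pow_pos h0 2), abs_mul, abs_mul, abs_mul,
    abs_of_pos hδ, abs_of_pos (zero_lt_two' ℝ)]
  have h1 : |1 - p ^ 2| ≤ 1 + p ^ 2 := by
    rw [abs_le]; constructor <;> nlinarith
  have h2 : |⟪y, a⟫| ≤ ‖y‖ * ‖a‖ := abs_real_inner_le_norm y a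
  have h3 : δ * (1 + p ^ 2) * p ≤ ((p + δ) * (1 + δ * p)) ^ 2 := by
    have e : (p + δ) * (1 + δ * p) = p * (1 + δ ^ 2) + δ * (1 + p ^ 2) := by ring
    rw [e]
    have k1 : p ≤ p * (1 + δ ^ 2) := by nlinarith [sq_nonneg δ]
    have k2 : 0 < δ * (1 + p ^ 2) := by positivity
    nlinarith
  calc 2 * |⟪y, a⟫| * (δ * |1 - p ^ 2|) ≤ 2 * (‖y‖ * ‖a‖) * (δ * (1 + p ^ 2)) := by gcongr
    _ = 2 * ‖a‖ * ‖y‖⁻¹ * (δ * (1 + p ^ 2) * p) := by rw [hp]; field_simp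
    _ ≤ _ := by gcongr

end Cutoff

/-! ### Integrability of radial functions and integration by parts -/

section Ambient

open Module Filter Topology

variable {E : Type*} [NormedAddCommGroup E] [InnerProductSpace ℝ E] [FiniteDimensional ℝ E]
  [MeasurableSpace E] [BorelSpace E]

theorem integrable_inv_norm_mul_inv_one_add_norm_pow (μ : Measure E) [μ.IsAddHaarMeasure]
    (hN : 2 ≤ finrank ℝ E) :
    Integrable (fun y : E ↦ ‖y‖⁻¹ * ((1 + ‖y‖) ^ finrank ℝ E)⁻¹) μ := by
  have : Nontrivial E := Module.nontrivial_of_finrank_pos (R := ℝ) (by omega)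
  refine (integrable_fun_norm_addHaar μ (f := fun r : ℝ ↦ r⁻¹ * ((1 + r) ^ finrank ℝ E)⁻¹)).2 ?_
  have h2 : IntegrableOn (fun r : ℝ ↦ (1 + ‖r‖) ^ (-(2 : ℝ))) (Ioi 0) :=
    (integrable_one_add_norm (by simp)).integrableOn
  refine h2.mono' (by fun_prop) ?_
  filter_upwards [ae_restrict_mem measurableSet_Ioi] with r hr
  have hr : 0 < r := hr
  obtain ⟨k, hk⟩ := Nat.exists_eq_add_of_le hN
  rw [hk, Real.norm_of_nonneg hr.le, Real.norm_of_nonneg (by positivity),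
    Real.rpow_neg (by positivity), show 2 + k - 1 = k + 1 by omega, smul_eq_mul]
  norm_cast
  rw [pow_succ, pow_add, mul_inv, mul_assoc, ← mul_assoc r, mul_inv_cancel₀ hr.ne', one_mul,
    mul_left_comm]
  refine mul_le_of_le_one_right (by positivity) ?_
  rw [← div_eq_mul_inv]
  exact div_le_one_of_le₀ (by gcongr; linarith) (by positivity)

theorem integrableOn_ball_norm_rpow (μ : Measure E) [μ.IsAddHaarMeasure] [Nontrivial E] {s : ℝ}
    (hs : -(finrank ℝ E : ℝ) < s) (R : ℝ) :
    IntegrableOn (fun y : E ↦ ‖y‖ ^ s) (ball 0 R) μ := by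
  refine (integrableOn_fun_norm_addHaar μ (f := fun r : ℝ ↦ r ^ s)).2 ?_
  have hpos : 0 < finrank ℝ E := finrank_pos
  have h : IntervalIntegrable (fun r : ℝ ↦ r ^ (s + (finrank ℝ E - 1 : ℝ))) volume 0 R :=
    intervalIntegral.intervalIntegrable_rpow' (by linarith)
  refine (h.1.mono_set Ioo_subset_Ioc_self).congr_fun (fun r hr ↦ ?_) measurableSet_Ioo
  rw [smul_eq_mul, mul_comm, ← Real.rpow_natCast, ← Real.rpow_add hr.1, Nat.cast_sub hpos,
    Nat.cast_one]

theorem aestronglyMeasurable_of_continuousOn_compl_zero {μ : Measure E} [μ.IsAddHaarMeasure]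
    [Nontrivial E] {F : Type*} [NormedAddCommGroup F]  {g : E → F}
    (hg : ContinuousOn g {0}ᶜ) : AEStronglyMeasurable g μ := by
  have := hg.aestronglyMeasurable (μ := μ) (measurableSet_singleton 0).compl
  rwa [restrict_compl_singleton] at this

/-- The integral of a directional derivative vanishes, for a bounded function that need not be
differentiable at the origin. Integrability of `q / |y|` replaces that of `q`, which may fail: in the
application `q` decays only like `|y| ^ (-dim)`. -/
theorem integral_eq_zero_of_hasLineDerivAt {μ : Measure E} [μ.IsAddHaarMeasure] [Nontrivial E]
    {q q' : E → ℝ} {a : E} {C : ℝ} (hq : ∀ y ≠ 0, HasLineDerivAt ℝ q (q' y) y a)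
    (hC : ∀ y, |q y| ≤ C) (hint : Integrable (fun y ↦ ‖y‖⁻¹ * q y) μ) (hint' : Integrable q' μ) :
    ∫ y, q' y ∂μ = 0 := by
  -- the derivative of the cutoff in the direction `a`
  set η' : ℝ → E → ℝ := fun δ y ↦ 2 * ⟪y, a⟫ * (δ * (1 - (‖y‖ ^ 2) ^ 2)) /
      ((‖y‖ ^ 2 + δ) * (1 + δ * ‖y‖ ^ 2)) ^ 2 with hη'
  have hη'c : ∀ δ > 0, Continuous (η' δ) := fun δ hδ ↦ by
    refine Continuous.div (by fun_prop) (by fun_prop) fun y ↦ by positivity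
  have hne : ∀ᵐ y ∂μ, y ≠ 0 := by
    simp [ae_iff, measure_singleton]
  have hqm : AEStronglyMeasurable q μ := by
    have h : AEStronglyMeasurable (fun y ↦ ‖y‖ * (‖y‖⁻¹ * q y)) μ :=
      (continuous_norm.aestronglyMeasurable).mul hint.aestronglyMeasurable
    refine h.congr ?_
    filter_upwards [hne] with y hy
    rw [mul_inv_cancel_left₀ (norm_ne_zero_iff.2 hy)]
  have hint1 : ∀ δ > 0, Integrable (fun y ↦ originCutoff δ y * q' y) μ := fun δ hδ ↦
    hint'.bdd_mul (c := 1) (continuous_originCutoff hδ).aestronglyMeasurable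
      (.of_forall fun y ↦ by
        rw [Real.norm_of_nonneg (originCutoff_nonneg hδ y)]; exact originCutoff_le_one hδ y)
  have hbd : ∀ δ > 0, ∀ y, ‖η' δ y * q y‖ ≤ 2 * ‖a‖ * ‖‖y‖⁻¹ * q y‖ := fun δ hδ y ↦ by
    rw [norm_mul, norm_mul, ← mul_assoc, norm_inv, norm_norm]
    exact mul_le_mul_of_nonneg_right (abs_deriv_originCutoff_le hδ y a) (norm_nonneg _)
  have hint2 : ∀ δ > 0, Integrable (fun y ↦ η' δ y * q y) μ := fun δ hδ ↦
    (hint.norm.const_mul (2 * ‖a‖)).mono' ((hη'c δ hδ).aestronglyMeasurable.mul hqm)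
      (.of_forall (hbd δ hδ))
  have hint3 : ∀ δ > 0, Integrable (fun y ↦ originCutoff δ y * q y) μ := fun δ hδ ↦ by
    refine (hint.norm.const_mul δ⁻¹).mono'
      ((continuous_originCutoff hδ).aestronglyMeasurable.mul hqm) ?_
    filter_upwards [hne] with y hy
    have hy : 0 < ‖y‖ := norm_pos_iff.2 hy
    rw [norm_mul, norm_mul, ← mul_assoc, Real.norm_of_nonneg (originCutoff_nonneg hδ y), norm_inv,
      norm_norm]
    refine mul_le_mul_of_nonneg_right ?_ (norm_nonneg _)
    unfold originCutoff
    rw [div_le_iff₀ (by positivity)]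
    have : δ⁻¹ * ‖y‖⁻¹ * ((‖y‖ ^ 2 + δ) * (1 + δ * ‖y‖ ^ 2))
      = ‖y‖ ^ 3 + ‖y‖ * (δ⁻¹ + δ) + ‖y‖⁻¹ := by field_simp; ring
    rw [this]
    have h1 : 0 ≤ ‖y‖⁻¹ := by positivity
    have h2 : 2 ≤ δ⁻¹ + δ := by
      have : δ⁻¹ + δ - 2 = δ⁻¹ * (δ - 1) ^ 2 := by field_simp; ring
      have : 0 ≤ δ⁻¹ * (δ - 1) ^ 2 := by positivity
      linarith
    nlinarith [mul_nonneg hy.le (sq_nonneg (‖y‖ - 1)), mul_le_mul_of_nonneg_left h2 hy.le]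
  have key : ∀ δ > 0, ∫ y, (originCutoff δ y * q' y + η' δ y * q y) ∂μ = 0 := fun δ hδ ↦ by
    have hd : ∀ y, HasLineDerivAt ℝ (fun y ↦ originCutoff δ y * q y)
        (originCutoff δ y * q' y + η' δ y * q y) y a := fun y ↦ by
      rcases eq_or_ne y 0 with rfl | hy
      -- at the origin the product is `O(t ^ 2)` along the line, as `q` is bounded
      · have e : originCutoff δ (0 : E) * q' 0 + η' δ 0 * q 0 = 0 := by
          simp [originCutoff, hη']
        rw [e]
        unfold HasLineDerivAt
        rw [hasDerivAt_iff_isLittleO_nhds_zero]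
        have hO : (fun t : ℝ ↦ originCutoff δ (t • a) * q (t • a)) =O[𝓝 0] fun t : ℝ ↦ t ^ 2 := by
          refine Asymptotics.IsBigO.of_bound (‖a‖ ^ 2 / δ * C) (.of_forall fun t ↦ ?_)
          rw [norm_mul, Real.norm_of_nonneg (originCutoff_nonneg hδ _), norm_pow]
          have h1 : originCutoff δ (t • a) ≤ ‖a‖ ^ 2 / δ * ‖t‖ ^ 2 := by
            unfold originCutoff
            rw [norm_smul, div_le_iff₀ (by positivity)]
            calc (‖t‖ * ‖a‖) ^ 2 = ‖a‖ ^ 2 / δ * ‖t‖ ^ 2 * (δ * 1) := by field_simp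
              _ ≤ _ := by
                gcongr
                · exact le_add_of_nonneg_left (by positivity)
                · exact le_add_of_nonneg_right (by positivity)
          calc _ ≤ (‖a‖ ^ 2 / δ * ‖t‖ ^ 2) * C := by
                gcongr
                exact hC _
            _ = _ := by ring
        have ho : (fun t : ℝ ↦ t ^ 2) =o[𝓝 0] fun t : ℝ ↦ t := by
          simpa using Asymptotics.isLittleO_pow_pow (𝕜 := ℝ) (m := 1) (n := 2) (by norm_num)
        simpa [originCutoff] using hO.trans_isLittleO ho
      · have h := HasDerivAt.mul (hasLineDerivAt_originCutoff hδ y a) (hq y hy)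
        unfold HasLineDerivAt
        convert! h using 1
        simp only [zero_smul, add_zero, hη']
        ring
    have hi := (hint1 δ hδ).add (hint2 δ hδ)
    have := integral_bilinear_hasLineDerivAt_right_eq_neg_left_of_integrable (μ := μ)
      (f := fun _ : E ↦ (1 : ℝ)) (f' := fun _ ↦ 0) (v := a) (B := ContinuousLinearMap.mul ℝ ℝ)
      (g := fun y ↦ originCutoff δ y * q y)
      (g' := fun y ↦ originCutoff δ y * q' y + η' δ y * q y)
      (by simp) (by simpa [Pi.add_def] using hi) (by simpa using hint3 δ hδ)
      (fun y _ ↦ hasDerivAt_const (0 : ℝ) (1 : ℝ)) (fun y _ ↦ hd y)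
    simpa using this
  have hlim : Tendsto (fun δ ↦ ∫ y, (originCutoff δ y * q' y + η' δ y * q y) ∂μ) (𝓝[>] 0)
      (𝓝 (∫ y, q' y ∂μ)) := by
    refine tendsto_integral_filter_of_dominated_convergence
      (fun y ↦ ‖q' y‖ + 2 * ‖a‖ * ‖‖y‖⁻¹ * q y‖) ?_ ?_
      (hint'.norm.add (hint.norm.const_mul _)) ?_
    · filter_upwards [self_mem_nhdsWithin] with δ hδ
      exact ((hint1 δ hδ).add (hint2 δ hδ)).aestronglyMeasurable
    · filter_upwards [self_mem_nhdsWithin] with δ hδ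
      refine .of_forall fun y ↦ (norm_add_le _ _).trans (add_le_add ?_ (hbd δ hδ y))
      rw [norm_mul, Real.norm_of_nonneg (originCutoff_nonneg hδ y)]
      exact mul_le_of_le_one_left (norm_nonneg _) (originCutoff_le_one hδ y)
    · filter_upwards [hne] with y hy
      have hy : ‖y‖ ≠ 0 := norm_ne_zero_iff.2 hy
      have hc : ContinuousAt (fun δ : ℝ ↦ originCutoff δ y * q' y + η' δ y * q y) 0 := by
        simp only [originCutoff, hη']
        refine ContinuousAt.add (.mul (.div ?_ ?_ ?_) ?_) (.mul (.div ?_ ?_ ?_) ?_) <;>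
          first | fun_prop | simp [hy]
      have := hc.tendsto
      have e : originCutoff 0 y * q' y + η' 0 y * q y = q' y := by
        simp [originCutoff, hη', hy]
      rw [e] at this
      exact this.mono_left nhdsWithin_le_nhds
  refine tendsto_nhds_unique hlim (tendsto_const_nhds.congr' ?_)
  filter_upwards [self_mem_nhdsWithin] with δ hδ
  exact (key δ hδ).symm

end Ambient

/-! ### The regularised second derivatives of the Newtonian potential -/

section Kernel

open Module Filter Topology

variable {E : Type*} [NormedAddCommGroup E]

/-- The regularisation `(|z| ^ 2 + ε ^ 2) ^ (-1/2)` of `|z|⁻¹`; for `ε = 0` it is `|z|⁻¹` itself. -/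
noncomputable def regInv (ε : ℝ) (z : E) : ℝ := (√(‖z‖ ^ 2 + ε ^ 2))⁻¹

theorem regInv_nonneg (ε : ℝ) (z : E) : 0 ≤ regInv ε z := by
  unfold regInv; positivity

theorem regInv_zero (z : E) : regInv 0 z = ‖z‖⁻¹ := by
  simp [regInv]

theorem regInv_sq {ε : ℝ} (hε : 0 < ε) (z : E) : (‖z‖ ^ 2 + ε ^ 2) * regInv ε z ^ 2 = 1 := by
  rw [regInv, inv_pow, Real.sq_sqrt (by positivity), mul_inv_cancel₀ (by positivity)]

theorem norm_mul_regInv_le_one (ε : ℝ) (z : E) : ‖z‖ * regInv ε z ≤ 1 := by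
  rw [regInv, ← div_eq_mul_inv]
  exact div_le_one_of_le₀ (Real.le_sqrt_of_sq_le (by linarith [sq_nonneg ε])) (by positivity)

theorem mul_regInv_le_one (ε : ℝ) (z : E) : ε * regInv ε z ≤ 1 := by
  rw [regInv, ← div_eq_mul_inv]
  exact div_le_one_of_le₀ (Real.le_sqrt_of_sq_le (by linarith [sq_nonneg ‖z‖])) (by positivity)

theorem regInv_le_inv_norm {z : E} (hz : z ≠ 0) (ε : ℝ) : regInv ε z ≤ ‖z‖⁻¹ := by
  have := norm_mul_regInv_le_one ε z
  have h : 0 < ‖z‖ := norm_pos_iff.2 hz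
  rwa [← one_div, le_div_iff₀' h]

theorem continuous_regInv {ε : ℝ} (hε : 0 < ε) : Continuous (regInv (E := E) ε) := by
  unfold regInv
  exact Continuous.inv₀ (by fun_prop) fun z ↦ by positivity

theorem continuousAt_regInv_zero {z : E} (hz : z ≠ 0) : ContinuousAt (fun ε ↦ regInv ε z) 0 := by
  unfold regInv
  refine ContinuousAt.inv₀ (by fun_prop) ?_
  simpa using hz

theorem regInv_eq_inv_mul [NormedSpace ℝ E] {ε : ℝ} (hε : 0 < ε) (z : E) :
    regInv ε z = ε⁻¹ * regInv 1 (ε⁻¹ • z) := by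
  have : ‖z‖ ^ 2 + ε ^ 2 = ε ^ 2 * (‖ε⁻¹ • z‖ ^ 2 + 1 ^ 2) := by
    rw [norm_smul, norm_inv, Real.norm_of_nonneg hε.le]
    field_simp
  rw [regInv, this, Real.sqrt_mul (by positivity), Real.sqrt_sq hε.le, mul_inv, regInv]

theorem regInv_sub_le {ε : ℝ} (hε : 0 < ε) (x y : E) :
    regInv ε (y - x) ≤ ((1 + ‖x‖) / ε + 1) * (1 + ‖y‖)⁻¹ := by
  rw [← div_eq_mul_inv, le_div_iff₀ (by positivity)]
  have h1 : ‖y‖ ≤ ‖x‖ + ‖y - x‖ := by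
    simpa using norm_add_le x (y - x)
  have h2 : regInv ε (y - x) ≤ 1 / ε := by
    rw [le_div_iff₀' hε]; exact mul_regInv_le_one ε _
  have h3 := norm_mul_regInv_le_one ε (y - x)
  have h4 := regInv_nonneg ε (y - x)
  calc regInv ε (y - x) * (1 + ‖y‖) ≤ regInv ε (y - x) * (1 + (‖x‖ + ‖y - x‖)) := by gcongr
    _ = (1 + ‖x‖) * regInv ε (y - x) + ‖y - x‖ * regInv ε (y - x) := by ring
    _ ≤ (1 + ‖x‖) * (1 / ε) + 1 := by gcongr
    _ = _ := by ring

variable [InnerProductSpace ℝ E]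

theorem hasLineDerivAt_regInv {ε : ℝ} (hε : 0 < ε) (z c : E) :
    HasLineDerivAt ℝ (regInv ε) (-(⟪c, z⟫ * regInv ε z ^ 3)) z c := by
  have hp : HasDerivAt (fun t : ℝ ↦ ‖z + t • c‖ ^ 2) (2 * ⟪z, c⟫) 0 := by
    have h : HasDerivAt (fun t : ℝ ↦ z + t • c) ((1 : ℝ) • c) 0 :=
      ((hasDerivAt_id (0 : ℝ)).smul_const c).const_add z
    simpa using h.norm_sq
  have h0 : 0 < ‖z‖ ^ 2 + ε ^ 2 := by positivity
  unfold HasLineDerivAt regInv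
  convert! ((hp.add_const (ε ^ 2)).sqrt (by simpa using h0.ne')).inv
    (by simpa using (Real.sqrt_pos.2 h0).ne') using 1
  simp only [zero_smul, add_zero]
  have := Real.sqrt_pos.2 h0
  rw [real_inner_comm]
  field_simp

/-- In dimension `N` and up to the factor `|S^(N-1)|`, the second derivative in the directions `a`, `b`
of the regularised Newtonian potential, which for `N ≥ 3` is a multiple
of `regInv ε ^ (N - 2)`. For `ε = 0` it is the singular kernel. -/
noncomputable def regKernel (N : ℕ) (ε : ℝ) (a b z : E) : ℝ :=
  ⟪a, b⟫ * regInv ε z ^ N - N * ⟪a, z⟫ * ⟪b, z⟫ * regInv ε z ^ (N + 2)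

/-- The derivative of `regKernel N ε a b` in the direction `c`, for `0 < ε`. It is symmetric in
`a`, `b`, `c`. -/
noncomputable def regKernelDeriv (N : ℕ) (ε : ℝ) (a b c z : E) : ℝ :=
  -N * (⟪a, b⟫ * ⟪c, z⟫ + ⟪a, c⟫ * ⟪b, z⟫ + ⟪b, c⟫ * ⟪a, z⟫) * regInv ε z ^ (N + 2)
    + N * (N + 2) * (⟪a, z⟫ * ⟪b, z⟫ * ⟪c, z⟫) * regInv ε z ^ (N + 4)

theorem regKernelDeriv_swap (N : ℕ) (ε : ℝ) (a b c z : E) :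
    regKernelDeriv N ε a b c z = regKernelDeriv N ε c b a z := by
  unfold regKernelDeriv
  rw [real_inner_comm a c, real_inner_comm b c, real_inner_comm a b]
  ring

theorem hasLineDerivAt_regKernel {N : ℕ} (hN : N ≠ 0) {ε : ℝ} (hε : 0 < ε) (a b c z : E) :
    HasLineDerivAt ℝ (regKernel N ε a b) (regKernelDeriv N ε a b c z) z c := by
  have hr : HasDerivAt (fun t : ℝ ↦ regInv ε (z + t • c)) _ 0 := hasLineDerivAt_regInv hε z c
  have hi : ∀ a : E, HasDerivAt (fun t : ℝ ↦ ⟪a, z + t • c⟫) ⟪a, c⟫ 0 := fun a ↦ by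
    have h : HasDerivAt (fun t : ℝ ↦ z + t • c) ((1 : ℝ) • c) 0 :=
      ((hasDerivAt_id (0 : ℝ)).smul_const c).const_add z
    simpa using (hasDerivAt_const (0 : ℝ) a).inner ℝ h
  unfold HasLineDerivAt regKernel
  convert! ((hr.pow N).const_mul ⟪a, b⟫).sub
    ((((hi a).const_mul (N : ℝ)).mul (hi b)).mul (hr.pow (N + 2))) using 1
  obtain ⟨k, rfl⟩ := Nat.exists_eq_succ_of_ne_zero hN
  simp only [regKernelDeriv, zero_smul, add_zero, Pi.mul_apply, Pi.pow_apply]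
  push_cast
  simp only [Nat.succ_eq_add_one]
  ring

theorem continuous_regKernel (N : ℕ) {ε : ℝ} (hε : 0 < ε) (a b : E) :
    Continuous (regKernel N ε a b) := by
  have := continuous_regInv (E := E) hε
  unfold regKernel
  fun_prop

theorem continuous_regKernelDeriv (N : ℕ) {ε : ℝ} (hε : 0 < ε) (a b c : E) :
    Continuous (regKernelDeriv N ε a b c) := by
  have := continuous_regInv (E := E) hε
  unfold regKernelDeriv
  fun_prop

theorem abs_inner_mul_regInv_le (ε : ℝ) (a z : E) : |⟪a, z⟫| * regInv ε z ≤ ‖a‖ := by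
  calc |⟪a, z⟫| * regInv ε z ≤ (‖a‖ * ‖z‖) * regInv ε z := by
        gcongr
        · exact regInv_nonneg ε z
        · exact abs_real_inner_le_norm a z
    _ = ‖a‖ * (‖z‖ * regInv ε z) := by ring
    _ ≤ ‖a‖ * 1 := by gcongr; exact norm_mul_regInv_le_one ε z
    _ = ‖a‖ := mul_one _

theorem abs_regKernel_le (N : ℕ) (ε : ℝ) (a b z : E) :
    |regKernel N ε a b z| ≤ (1 + N) * (‖a‖ * ‖b‖) * regInv ε z ^ N := by
  have hr := regInv_nonneg ε z
  have ha := abs_inner_mul_regInv_le ε a z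
  have hb := abs_inner_mul_regInv_le ε b z
  have hab := abs_real_inner_le_norm a b
  unfold regKernel
  refine (abs_sub _ _).trans ?_
  rw [abs_mul, abs_mul, abs_mul, abs_mul, abs_of_nonneg (pow_nonneg hr _),
    abs_of_nonneg (pow_nonneg hr _), Nat.abs_cast]
  calc _ = |⟪a, b⟫| * regInv ε z ^ N +
      N * ((|⟪a, z⟫| * regInv ε z) * (|⟪b, z⟫| * regInv ε z)) * regInv ε z ^ N := by ring
    _ ≤ (‖a‖ * ‖b‖) * regInv ε z ^ N + N * (‖a‖ * ‖b‖) * regInv ε z ^ N := by gcongr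
    _ = _ := by ring

theorem abs_regKernelDeriv_le (N : ℕ) (ε : ℝ) (a b c z : E) :
    |regKernelDeriv N ε a b c z| ≤
      (3 * N + N * (N + 2)) * (‖a‖ * ‖b‖ * ‖c‖) * regInv ε z ^ (N + 1) := by
  have hr := regInv_nonneg ε z
  have ha := abs_inner_mul_regInv_le ε a z
  have hb := abs_inner_mul_regInv_le ε b z
  have hc := abs_inner_mul_regInv_le ε c z
  have hab := abs_real_inner_le_norm a b
  have hac := abs_real_inner_le_norm a c
  have hbc := abs_real_inner_le_norm b c
  unfold regKernelDeriv
  refine (abs_add_le _ _).trans ?_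
  have h3 : |⟪a, b⟫ * ⟪c, z⟫ + ⟪a, c⟫ * ⟪b, z⟫ + ⟪b, c⟫ * ⟪a, z⟫| ≤
      |⟪a, b⟫| * |⟪c, z⟫| + |⟪a, c⟫| * |⟪b, z⟫| + |⟪b, c⟫| * |⟪a, z⟫| := by
    refine (abs_add_three _ _ _).trans ?_
    simp only [abs_mul, le_refl]
  rw [abs_mul, abs_mul, abs_neg, Nat.abs_cast, abs_of_nonneg (pow_nonneg hr _), abs_mul _ (_ ^ _),
    abs_of_nonneg (pow_nonneg hr _), abs_mul, abs_mul (⟪a, z⟫ * ⟪b, z⟫), abs_mul ⟪a, z⟫,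
    abs_of_nonneg (by positivity : (0 : ℝ) ≤ N * (N + 2))]
  calc _ ≤ (N : ℝ) * (|⟪a, b⟫| * |⟪c, z⟫| + |⟪a, c⟫| * |⟪b, z⟫| + |⟪b, c⟫| * |⟪a, z⟫|) *
        regInv ε z ^ (N + 2) +
        N * (N + 2) * (|⟪a, z⟫| * |⟪b, z⟫| * |⟪c, z⟫|) * regInv ε z ^ (N + 4) := by gcongr
    _ = N * (|⟪a, b⟫| * (|⟪c, z⟫| * regInv ε z) + |⟪a, c⟫| * (|⟪b, z⟫| * regInv ε z)
          + |⟪b, c⟫| * (|⟪a, z⟫| * regInv ε z)) * regInv ε z ^ (N + 1) +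
        N * (N + 2) * ((|⟪a, z⟫| * regInv ε z) * (|⟪b, z⟫| * regInv ε z) *
          (|⟪c, z⟫| * regInv ε z)) * regInv ε z ^ (N + 1) := by ring
    _ ≤ N * ((‖a‖ * ‖b‖) * ‖c‖ + (‖a‖ * ‖c‖) * ‖b‖
          + (‖b‖ * ‖c‖) * ‖a‖) * regInv ε z ^ (N + 1) +
        N * (N + 2) * (‖a‖ * ‖b‖ * ‖c‖) * regInv ε z ^ (N + 1) := by gcongr
    _ = _ := by ring

/-- The Laplacian of the regularised potential: a multiple of an approximate identity. -/
theorem sum_regKernel {ι : Type*} [Fintype ι] (e : OrthonormalBasis ι ℝ E) {ε : ℝ} (hε : 0 < ε)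
    (z : E) : ∑ i, regKernel (Fintype.card ι) ε (e i) (e i) z =
      Fintype.card ι * (ε ^ 2 * regInv ε z ^ (Fintype.card ι + 2)) := by
  have h1 : ∑ i, ⟪e i, z⟫ * ⟪e i, z⟫ = ‖z‖ ^ 2 := by
    rw [← real_inner_self_eq_norm_sq, ← e.sum_inner_mul_inner z z]
    simp only [real_inner_comm]
  have h2 := regInv_sq hε z
  calc _ = ∑ i, (regInv ε z ^ Fintype.card ι
        - Fintype.card ι * regInv ε z ^ (Fintype.card ι + 2) * (⟪e i, z⟫ * ⟪e i, z⟫)) := by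
        refine Finset.sum_congr rfl fun i _ ↦ ?_
        simp only [regKernel, real_inner_self_eq_norm_sq, e.norm_eq_one]
        ring
    _ = _ := by
        rw [Finset.sum_sub_distrib, ← Finset.mul_sum, h1, Finset.sum_const, Finset.card_univ,
          nsmul_eq_mul]
        linear_combination (-Fintype.card ι * regInv ε z ^ Fintype.card ι) * h2

theorem tendsto_regKernel {N : ℕ} (a b : E) {z : E} (hz : z ≠ 0) :
    Tendsto (fun ε ↦ regKernel N ε a b z) (𝓝 0) (𝓝 (regKernel N 0 a b z)) := by
  have := continuousAt_regInv_zero hz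
  have h : ContinuousAt (fun ε ↦ regKernel N ε a b z) 0 := by
    unfold regKernel
    fun_prop
  exact h

variable [FiniteDimensional ℝ E] [MeasurableSpace E] [BorelSpace E]

/-- The total mass of the approximate identity. -/
theorem integral_regInv_one_pow (μ : Measure E) [μ.IsAddHaarMeasure] [Nontrivial E] :
    ∫ z : E, regInv 1 z ^ (finrank ℝ E + 2) ∂μ = μ.real (ball 0 1) := by
  have hN : 0 < finrank ℝ E := finrank_pos
  set N := finrank ℝ E with hNdef
  have h := integral_fun_norm_addHaar μ (fun t : ℝ ↦ regInv 1 t ^ (N + 2))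
  have e : ∀ z : E, regInv 1 ‖z‖ = regInv 1 z := fun z ↦ by simp [regInv]
  simp only [e, smul_eq_mul, nsmul_eq_mul] at h
  rw [h, ← hNdef]
  have hd : ∀ t : ℝ, HasDerivAt (regInv (E := ℝ) 1) (-(t * regInv 1 t ^ 3)) t := fun t ↦ by
    have h1 : HasDerivAt (fun s : ℝ ↦ regInv 1 (t + s • (1 : ℝ)))
        (-(⟪(1 : ℝ), t⟫ * regInv 1 t ^ 3)) (t - t) := by
      rw [sub_self]
      exact hasLineDerivAt_regInv one_pos t (1 : ℝ)
    simpa using h1.comp_sub_const t t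
  -- an explicit primitive of the radial integrand
  have hG : ∀ t : ℝ, HasDerivAt (fun t : ℝ ↦ (N : ℝ)⁻¹ * (t * regInv 1 t) ^ N)
      (t ^ (N - 1) * regInv 1 t ^ (N + 2)) t := fun t ↦ by
    convert! (((hasDerivAt_id t).mul (hd t)).pow N).const_mul (N : ℝ)⁻¹ using 1
    obtain ⟨k, hk⟩ := Nat.exists_eq_succ_of_ne_zero hN.ne'
    rw [hk]
    have h2 := regInv_sq one_pos t
    rw [Real.norm_eq_abs, sq_abs] at h2
    simp only [Nat.succ_eq_add_one, Nat.add_sub_cancel, Pi.mul_apply, id_eq]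
    field_simp
    linear_combination (t ^ k * regInv 1 t ^ (k + 1)) * h2
  have hr0 : Tendsto (regInv (E := ℝ) 1) atTop (𝓝 0) := by
    refine squeeze_zero' (.of_forall (regInv_nonneg 1)) ?_ tendsto_inv_atTop_zero
    filter_upwards [eventually_gt_atTop 0] with t ht
    simpa [abs_of_pos ht] using regInv_le_inv_norm ht.ne' 1
  have hlim : Tendsto (fun t : ℝ ↦ (N : ℝ)⁻¹ * (t * regInv 1 t) ^ N) atTop (𝓝 (N : ℝ)⁻¹) := by
    have h1 : Tendsto (fun t : ℝ ↦ √(1 - regInv 1 t ^ 2)) atTop (𝓝 1) := by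
      have : Tendsto (fun t : ℝ ↦ 1 - regInv 1 t ^ 2) atTop (𝓝 1) := by
        simpa using (hr0.pow 2).const_sub 1
      simpa using this.sqrt
    have h2 : Tendsto (fun t : ℝ ↦ t * regInv 1 t) atTop (𝓝 1) := by
      refine h1.congr' ?_
      filter_upwards [eventually_gt_atTop 0] with t ht
      have h2 := regInv_sq one_pos t
      rw [Real.norm_eq_abs, sq_abs] at h2
      rw [show 1 - regInv 1 t ^ 2 = (t * regInv 1 t) ^ 2 by linear_combination -h2,
        Real.sqrt_sq (mul_nonneg ht.le (regInv_nonneg _ _))]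
    simpa using (h2.pow N).const_mul (N : ℝ)⁻¹
  rw [integral_Ioi_of_hasDerivAt_of_nonneg' (fun t _ ↦ hG t)
    (fun t (ht : 0 < t) ↦ by have := regInv_nonneg 1 t; positivity) hlim]
  simp only [zero_mul, zero_pow hN.ne', mul_zero, sub_zero]
  field_simp

end Kernel

/-! ### Derivatives of functions homogeneous of degree one -/

section Homogeneous

open Module Filter Topology

variable {E : Type*} [NormedAddCommGroup E] [NormedSpace ℝ E] {W : E → ℝ}

theorem fderiv_smul_of_homogeneous (hhom : ∀ c : ℝ, 0 < c → ∀ y, W (c • y) = c * W y)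
    {c : ℝ} (hc : 0 < c) (y : E) : fderiv ℝ W (c • y) = fderiv ℝ W y := by
  have h := fderiv_comp_smul (f := W) (x := y) c
  rw [show (W <| c • ·) = c • W from funext (hhom c hc), fderiv_const_smul_field] at h
  exact (smul_right_injective _ hc.ne' h).symm

theorem hessian_smul_of_homogeneous (hhom : ∀ c : ℝ, 0 < c → ∀ y, W (c • y) = c * W y)
    {c : ℝ} (hc : 0 < c) (y : E) :
    fderiv ℝ (fderiv ℝ W) (c • y) = c⁻¹ • fderiv ℝ (fderiv ℝ W) y := by
  have h := fderiv_comp_smul (f := fderiv ℝ W) (x := y) c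
  rw [show (fderiv ℝ W <| c • ·) = fderiv ℝ W from
    funext (fderiv_smul_of_homogeneous hhom hc)] at h
  rw [h, inv_smul_smul₀ hc.ne']

theorem continuousOn_fderiv_compl_zero (hW : ContDiffOn ℝ 2 W {0}ᶜ) :
    ContinuousOn (fderiv ℝ W) {0}ᶜ :=
  hW.continuousOn_fderiv_of_isOpen isOpen_compl_singleton (by norm_num)

theorem contDiffOn_fderiv_compl_zero (hW : ContDiffOn ℝ 2 W {0}ᶜ) :
    ContDiffOn ℝ 1 (fderiv ℝ W) {0}ᶜ :=
  hW.fderiv_of_isOpen isOpen_compl_singleton (by norm_num)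

theorem continuousOn_hessian_compl_zero (hW : ContDiffOn ℝ 2 W {0}ᶜ) :
    ContinuousOn (fderiv ℝ (fderiv ℝ W)) {0}ᶜ :=
  (contDiffOn_fderiv_compl_zero hW).continuousOn_fderiv_of_isOpen isOpen_compl_singleton le_rfl

theorem hasFDerivAt_of_contDiffOn_compl_zero (hW : ContDiffOn ℝ 2 W {0}ᶜ) {y : E} (hy : y ≠ 0) :
    HasFDerivAt W (fderiv ℝ W y) y :=
  ((hW.contDiffAt (isOpen_compl_singleton.mem_nhds hy)).differentiableAt (by norm_num)).hasFDerivAt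

theorem hasFDerivAt_fderiv_of_contDiffOn_compl_zero (hW : ContDiffOn ℝ 2 W {0}ᶜ) {y : E}
    (hy : y ≠ 0) : HasFDerivAt (fderiv ℝ W) (fderiv ℝ (fderiv ℝ W) y) y :=
  (((contDiffOn_fderiv_compl_zero hW).contDiffAt
    (isOpen_compl_singleton.mem_nhds hy)).differentiableAt (by norm_num)).hasFDerivAt

/-- Symmetry of second derivatives away from the origin. -/
theorem hessian_symm_of_contDiffOn_compl_zero (hW : ContDiffOn ℝ 2 W {0}ᶜ) {y : E} (hy : y ≠ 0)
    (a b : E) : fderiv ℝ (fderiv ℝ W) y a b = fderiv ℝ (fderiv ℝ W) y b a :=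
  ((hW.contDiffAt (isOpen_compl_singleton.mem_nhds hy)).isSymmSndFDerivAt (by simp)) a b

theorem exists_bound_on_unit_sphere [FiniteDimensional ℝ E] {F : Type*} [NormedAddCommGroup F]
    {g : E → F} (hg : ContinuousOn g {0}ᶜ) : ∃ C, 0 ≤ C ∧ ∀ y, ‖y‖ = 1 → ‖g y‖ ≤ C := by
  obtain ⟨C, hC⟩ := (isCompact_sphere (0 : E) 1).exists_bound_of_continuousOn
    (hg.mono fun y hy ↦ ne_of_mem_sphere hy one_ne_zero)
  exact ⟨max C 0, le_max_right _ _, fun y hy ↦ (hC y (by simpa using hy)).trans (le_max_left _ _)⟩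

theorem exists_bound_fderiv_of_homogeneous [FiniteDimensional ℝ E] (hW : ContDiffOn ℝ 2 W {0}ᶜ)
    (hhom : ∀ c : ℝ, 0 < c → ∀ y, W (c • y) = c * W y) :
    ∃ C, 0 ≤ C ∧ ∀ y, ‖fderiv ℝ W y‖ ≤ C := by
  obtain ⟨C, hC0, hC⟩ := exists_bound_on_unit_sphere (continuousOn_fderiv_compl_zero hW)
  refine ⟨max C ‖fderiv ℝ W 0‖, hC0.trans (le_max_left _ _), fun y ↦ ?_⟩
  rcases eq_or_ne y 0 with rfl | hy
  · exact le_max_right _ _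
  have h : 0 < ‖y‖ := norm_pos_iff.2 hy
  rw [← fderiv_smul_of_homogeneous hhom (inv_pos.2 h) y]
  refine (hC _ ?_).trans (le_max_left _ _)
  rw [norm_smul, norm_inv, norm_norm, inv_mul_cancel₀ h.ne']

theorem exists_bound_hessian_of_homogeneous [FiniteDimensional ℝ E] (hW : ContDiffOn ℝ 2 W {0}ᶜ)
    (hhom : ∀ c : ℝ, 0 < c → ∀ y, W (c • y) = c * W y) :
    ∃ C, 0 ≤ C ∧ ∀ y ≠ 0, ‖fderiv ℝ (fderiv ℝ W) y‖ ≤ C * ‖y‖⁻¹ := by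
  obtain ⟨C, hC0, hC⟩ := exists_bound_on_unit_sphere (F := E →L[ℝ] E →L[ℝ] ℝ)
    (continuousOn_hessian_compl_zero hW)
  refine ⟨C, hC0, fun y hy ↦ ?_⟩
  have h : 0 < ‖y‖ := norm_pos_iff.2 hy
  have e : fderiv ℝ (fderiv ℝ W) y = ‖y‖⁻¹ • fderiv ℝ (fderiv ℝ W) (‖y‖⁻¹ • y) := by
    rw [hessian_smul_of_homogeneous hhom (inv_pos.2 h), inv_inv, inv_smul_smul₀ h.ne']
  rw [e]
  refine (ContinuousLinearMap.opNorm_smul_le _ _).trans ?_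
  rw [norm_inv, norm_norm, mul_comm]
  refine mul_le_mul_of_nonneg_right (hC _ ?_) (by positivity)
  rw [norm_smul, norm_inv, norm_norm, inv_mul_cancel₀ h.ne']

end Homogeneous

/-! ### The singular integral representation of second derivatives -/

section Representation

open Module Filter Topology

variable {E : Type*} [NormedAddCommGroup E] [InnerProductSpace ℝ E] [FiniteDimensional ℝ E]
  [MeasurableSpace E] [BorelSpace E] {W : E → ℝ}

theorem integrable_of_le_inv_norm_mul_regInv {μ : Measure E} [μ.IsAddHaarMeasure]
    (hN : 2 ≤ finrank ℝ E) {ε : ℝ} (hε : 0 < ε) (x : E) {g : E → ℝ}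
    (hg : AEStronglyMeasurable g μ) {C : ℝ} (hC : 0 ≤ C)
    (hbd : ∀ y ≠ 0, |g y| ≤ C * (‖y‖⁻¹ * regInv ε (y - x) ^ finrank ℝ E)) : Integrable g μ := by
  have : Nontrivial E := Module.nontrivial_of_finrank_pos (R := ℝ) (by omega)
  refine ((integrable_inv_norm_mul_inv_one_add_norm_pow μ hN).const_mul
    (C * ((1 + ‖x‖) / ε + 1) ^ finrank ℝ E)).mono' hg ?_
  have hne : ∀ᵐ y ∂μ, y ≠ 0 := by simp [ae_iff, measure_singleton]
  filter_upwards [hne] with y hy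
  refine (hbd y hy).trans ?_
  have h := pow_le_pow_left₀ (regInv_nonneg ε (y - x)) (regInv_sub_le hε x y) (finrank ℝ E)
  rw [mul_pow, inv_pow] at h
  calc _ ≤ C * (‖y‖⁻¹ * (((1 + ‖x‖) / ε + 1) ^ finrank ℝ E * ((1 + ‖y‖) ^ finrank ℝ E)⁻¹)) := by
        gcongr
    _ = _ := by ring

theorem abs_apply_apply_le {F : Type*} [NormedAddCommGroup F] [NormedSpace ℝ F]
    (L : F →L[ℝ] F →L[ℝ] ℝ) (a b : F) : |L a b| ≤ ‖L‖ * (‖a‖ * ‖b‖) := by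
  rw [← mul_assoc]
  exact L.le_opNorm₂ a b

/-- The product is of order `|y|⁻¹` at the origin and `|y| ^ (-dim - 1)` at infinity. -/
theorem integrable_hessian_mul_regKernel {μ : Measure E} [μ.IsAddHaarMeasure]
    (hN : 2 ≤ finrank ℝ E) (hW : ContDiffOn ℝ 2 W {0}ᶜ)
    (hhom : ∀ c : ℝ, 0 < c → ∀ y, W (c • y) = c * W y) {ε : ℝ} (hε : 0 < ε) (x a b c d : E) :
    Integrable (fun y ↦ fderiv ℝ (fderiv ℝ W) y b a * regKernel (finrank ℝ E) ε c d (y - x)) μ := by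
  have : Nontrivial E := Module.nontrivial_of_finrank_pos (R := ℝ) (by omega)
  obtain ⟨C, hC0, hC⟩ := exists_bound_hessian_of_homogeneous hW hhom
  have hm : AEStronglyMeasurable (fun y ↦ fderiv ℝ (fderiv ℝ W) y b a) μ :=
    aestronglyMeasurable_of_continuousOn_compl_zero
      (((continuousOn_hessian_compl_zero hW).clm_apply continuousOn_const).clm_apply
        continuousOn_const)
  refine integrable_of_le_inv_norm_mul_regInv hN hε x (hm.mul
    ((continuous_regKernel _ hε c d).comp (continuous_sub_right x)).aestronglyMeasurable)
    (C := C * (‖b‖ * ‖a‖) * ((1 + finrank ℝ E) * (‖c‖ * ‖d‖))) (by positivity) fun y hy ↦ ?_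
  rw [abs_mul]
  calc _ ≤ (C * ‖y‖⁻¹ * (‖b‖ * ‖a‖)) *
        ((1 + finrank ℝ E) * (‖c‖ * ‖d‖) * regInv ε (y - x) ^ finrank ℝ E) := by
        refine mul_le_mul ?_ (abs_regKernel_le _ _ _ _ _) (abs_nonneg _) (by positivity)
        refine (abs_apply_apply_le _ _ _).trans ?_
        gcongr
        exact hC y hy
    _ = _ := by ring

/-- Two integrations by parts, through the symmetric third derivative of the regularised potential,
exchange a direction of the Hessian of `W` with one of the kernel. -/
theorem integral_hessian_mul_regKernel_swap {μ : Measure E} [μ.IsAddHaarMeasure]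
    (hN : 2 ≤ finrank ℝ E) (hW : ContDiffOn ℝ 2 W {0}ᶜ)
    (hhom : ∀ c : ℝ, 0 < c → ∀ y, W (c • y) = c * W y) {ε : ℝ} (hε : 0 < ε) (x a b c d : E) :
    ∫ y, fderiv ℝ (fderiv ℝ W) y b a * regKernel (finrank ℝ E) ε c d (y - x) ∂μ =
      ∫ y, fderiv ℝ (fderiv ℝ W) y c a * regKernel (finrank ℝ E) ε b d (y - x) ∂μ := by
  have : Nontrivial E := Module.nontrivial_of_finrank_pos (R := ℝ) (by omega)
  obtain ⟨C, hC0, hC⟩ := exists_bound_fderiv_of_homogeneous hW hhom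
  have hm : AEStronglyMeasurable (fun y ↦ fderiv ℝ W y a) μ :=
    aestronglyMeasurable_of_continuousOn_compl_zero
      ((continuousOn_fderiv_compl_zero hW).clm_apply continuousOn_const)
  set N := finrank ℝ E with hNdef
  have hCa : ∀ y, |fderiv ℝ W y a| ≤ C * ‖a‖ := fun y ↦ (fderiv ℝ W y).le_of_opNorm_le (hC y) a
  have hint : ∀ b c d, Integrable
      (fun y ↦ fderiv ℝ W y a * regKernelDeriv N ε c d b (y - x)) μ := fun b c d ↦ by
    refine integrable_of_le_inv_norm_mul_regInv hN hε x (hm.mul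
      ((continuous_regKernelDeriv _ hε c d b).comp (continuous_sub_right x)).aestronglyMeasurable)
      (C := C * ‖a‖ * ((3 * N + N * (N + 2)) * (‖c‖ * ‖d‖ * ‖b‖)) * ((1 + ‖x‖) / ε + 1))
      (by positivity) fun y hy ↦ ?_
    have hy : 0 < ‖y‖ := norm_pos_iff.2 hy
    have hr := regInv_nonneg ε (y - x)
    have h1 : regInv ε (y - x) ≤ ((1 + ‖x‖) / ε + 1) * ‖y‖⁻¹ := by
      refine (regInv_sub_le hε x y).trans ?_
      gcongr
      linarith
    rw [abs_mul]
    calc _ ≤ C * ‖a‖ * ((3 * N + N * (N + 2)) * (‖c‖ * ‖d‖ * ‖b‖) *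
          (regInv ε (y - x) ^ N * (((1 + ‖x‖) / ε + 1) * ‖y‖⁻¹))) := by
          refine mul_le_mul (hCa y) ((abs_regKernelDeriv_le _ _ _ _ _ _).trans ?_)
            (abs_nonneg _) (by positivity)
          rw [pow_succ]
          gcongr
      _ = _ := by ring
  have key : ∀ b c d, ∫ y, fderiv ℝ (fderiv ℝ W) y b a * regKernel N ε c d (y - x) ∂μ =
      -∫ y, fderiv ℝ W y a * regKernelDeriv N ε c d b (y - x) ∂μ := fun b c d ↦ by
    have h1 := integrable_hessian_mul_regKernel (μ := μ) hN hW hhom hε x a b c d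
    have h0 := integral_eq_zero_of_hasLineDerivAt (μ := μ) (a := b)
      (q := fun y ↦ fderiv ℝ W y a * regKernel N ε c d (y - x))
      (q' := fun y ↦ fderiv ℝ (fderiv ℝ W) y b a * regKernel N ε c d (y - x) +
        fderiv ℝ W y a * regKernelDeriv N ε c d b (y - x))
      (C := C * ‖a‖ * ((1 + N) * (‖c‖ * ‖d‖) * ε⁻¹ ^ N)) ?_ ?_ ?_ (h1.add (hint b c d))
    · rw [integral_add h1 (hint b c d)] at h0
      linarith
    · intro y hy
      have d1 : HasLineDerivAt ℝ (fun y ↦ fderiv ℝ W y a) (fderiv ℝ (fderiv ℝ W) y b a) y b := by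
        have := ((hasFDerivAt_fderiv_of_contDiffOn_compl_zero hW hy).clm_apply
          (hasFDerivAt_const a y)).hasLineDerivAt b
        simpa using this
      have d2 : HasDerivAt (fun t : ℝ ↦ regKernel N ε c d (y + t • b - x))
          (regKernelDeriv N ε c d b (y - x)) 0 := by
        have : HasDerivAt (fun t : ℝ ↦ regKernel N ε c d (y - x + t • b))
          (regKernelDeriv N ε c d b (y - x)) 0 :=
          hasLineDerivAt_regKernel (by omega) hε c d b (y - x)
        refine this.congr_of_eventuallyEq (.of_forall fun t ↦ ?_)
        simp only [add_sub_right_comm]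
      have := HasDerivAt.mul d1 d2
      unfold HasLineDerivAt
      convert! this using 1
      simp
    · intro y
      rw [abs_mul]
      refine mul_le_mul (hCa y) ((abs_regKernel_le _ _ _ _ _).trans ?_) (abs_nonneg _)
        (by positivity)
      have := regInv_nonneg ε (y - x)
      gcongr
      rw [← one_div, le_div_iff₀' hε]
      exact mul_regInv_le_one ε _
    · refine integrable_of_le_inv_norm_mul_regInv hN hε x
        ((measurable_norm.inv.aestronglyMeasurable).mul (hm.mul
        ((continuous_regKernel _ hε c d).comp (continuous_sub_right x)).aestronglyMeasurable))
        (C := C * ‖a‖ * ((1 + N) * (‖c‖ * ‖d‖))) (by positivity) fun y hy ↦ ?_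
      rw [abs_mul, abs_mul, abs_of_nonneg (by positivity : 0 ≤ ‖y‖⁻¹)]
      calc _ ≤ ‖y‖⁻¹ * ((C * ‖a‖) * ((1 + N) * (‖c‖ * ‖d‖) * regInv ε (y - x) ^ N)) := by
            gcongr
            · exact hCa y
            · exact abs_regKernel_le _ _ _ _ _
        _ = _ := by ring
  rw [key, key]
  simp only [regKernelDeriv_swap N ε c d b]

/-- The two second derivatives in `∂_ξξ W` and the two in the Laplacian of the regularised potential
change places. -/
theorem integral_hessian_mul_regInv {μ : Measure E} [μ.IsAddHaarMeasure]
    (hN : 2 ≤ finrank ℝ E) (hW : ContDiffOn ℝ 2 W {0}ᶜ)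
    (hhom : ∀ c : ℝ, 0 < c → ∀ y, W (c • y) = c * W y) {ι : Type*} [Fintype ι]
    (e : OrthonormalBasis ι ℝ E) {ε : ℝ} (hε : 0 < ε) (x ξ : E) :
    ∫ y, fderiv ℝ (fderiv ℝ W) y ξ ξ *
        (finrank ℝ E * (ε ^ 2 * regInv ε (y - x) ^ (finrank ℝ E + 2))) ∂μ =
      ∫ y, (∑ i, fderiv ℝ (fderiv ℝ W) y (e i) (e i)) *
        regKernel (finrank ℝ E) ε ξ ξ (y - x) ∂μ := by
  have : Nontrivial E := Module.nontrivial_of_finrank_pos (R := ℝ) (by omega)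
  have hcard : finrank ℝ E = Fintype.card ι := finrank_eq_card_basis e.toBasis
  have hne : ∀ᵐ y ∂μ, y ≠ 0 := by simp [ae_iff, measure_singleton]
  have hi : ∀ i, ∫ y, fderiv ℝ (fderiv ℝ W) y ξ ξ *
      regKernel (finrank ℝ E) ε (e i) (e i) (y - x) ∂μ =
      ∫ y, fderiv ℝ (fderiv ℝ W) y (e i) (e i) * regKernel (finrank ℝ E) ε ξ ξ (y - x) ∂μ :=
    fun i ↦ by
      -- both sides reduce to the integral of `∂_i ∂_ξ W` against the `(i, ξ)` kernel
      rw [integral_hessian_mul_regKernel_swap hN hW hhom hε,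
        ← integral_hessian_mul_regKernel_swap hN hW hhom hε x (e i) ξ (e i) ξ]
      refine integral_congr_ae ?_
      filter_upwards [hne] with y hy
      rw [hessian_symm_of_contDiffOn_compl_zero hW hy]
      simp only [regKernel, real_inner_comm (e i) ξ]
      ring
  simp only [Finset.sum_mul]
  rw [integral_finsetSum _ fun i _ ↦ integrable_hessian_mul_regKernel hN hW hhom hε x _ _ _ _]
  simp only [← hi]
  rw [← integral_finsetSum _ fun i _ ↦
    integrable_hessian_mul_regKernel hN hW hhom hε x _ _ _ _]
  simp only [← Finset.mul_sum, hcard, sum_regKernel e hε]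

/-- The Laplacians of the regularised potentials concentrate at `x`. As `g` is not integrable at
infinity, it is cut at a ball around `x`; the general result on peak functions covers the inside. -/
theorem tendsto_integral_mul_regInv {μ : Measure E} [μ.IsAddHaarMeasure]
    (hN : 2 ≤ finrank ℝ E) {x : E} (hx : x ≠ 0) {g : E → ℝ} (hg : ContinuousOn g {0}ᶜ) {C : ℝ}
    (hC : ∀ y ≠ 0, |g y| ≤ C * ‖y‖⁻¹) :
    Tendsto (fun ε ↦ ∫ y, g y * (ε ^ 2 * regInv ε (y - x) ^ (finrank ℝ E + 2)) ∂μ) (𝓝[>] 0)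
      (𝓝 (μ.real (ball (0 : E) 1) * g x)) := by
  have : Nontrivial E := Module.nontrivial_of_finrank_pos (R := ℝ) (by omega)
  set N := finrank ℝ E with hNdef
  set V := μ.real (ball (0 : E) 1) with hV
  have hVpos : 0 < V := ENNReal.toReal_pos (measure_ball_pos μ _ one_pos).ne' measure_ball_lt_top.ne
  have hxn : 0 < ‖x‖ := norm_pos_iff.2 hx
  set δ := ‖x‖ / 2 with hδ
  have hδ0 : 0 < δ := by positivity
  have hC0 : 0 ≤ C := by
    have := (abs_nonneg _).trans (hC x hx)
    exact nonneg_of_mul_nonneg_left this (by positivity)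
  have hgm : AEStronglyMeasurable g μ := aestronglyMeasurable_of_continuousOn_compl_zero hg
  have hne : ∀ᵐ y ∂μ, y ≠ 0 := by simp [ae_iff, measure_singleton]
  set g₁ := (ball x δ).indicator g with hg₁
  set g₂ := (ball x δ)ᶜ.indicator g with hg₂
  have hg12 : ∀ y, g y = g₁ y + g₂ y := fun y ↦ (indicator_self_add_compl_apply _ _ _).symm
  have hballnorm : ∀ y ∈ ball x δ, δ ≤ ‖y‖ := fun y hy ↦ by
    rw [mem_ball, dist_eq_norm] at hy
    have := norm_sub_norm_le x (x - y)
    rw [sub_sub_cancel, norm_sub_rev] at this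
    linarith
  have hg₁i : Integrable g₁ μ := by
    rw [hg₁, integrable_indicator_iff measurableSet_ball]
    refine Measure.integrableOn_of_bounded (M := C * δ⁻¹) measure_ball_lt_top.ne hgm ?_
    filter_upwards [ae_restrict_mem measurableSet_ball] with y hy
    have h := hballnorm y hy
    refine (hC y (norm_pos_iff.1 (hδ0.trans_le h))).trans ?_
    gcongr
  have hg₁c : ContinuousAt g₁ x := by
    refine (hg.continuousAt (isOpen_compl_singleton.mem_nhds hx)).congr ?_
    filter_upwards [ball_mem_nhds x hδ0] with y hy
    rw [hg₁, indicator_of_mem hy]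
  have hg₁x : g₁ x = g x := indicator_of_mem (mem_ball_self hδ0) _
  -- the mass concentrating at `x`
  have hnear : Tendsto (fun ε ↦ ∫ y, g₁ y * (ε ^ 2 * regInv ε (y - x) ^ (N + 2)) ∂μ) (𝓝[>] 0)
      (𝓝 (V * g x)) := by
    have h := tendsto_integral_comp_smul_smul_of_integrable' (μ := μ) (x₀ := x)
      (φ := fun z : E ↦ V⁻¹ * regInv 1 z ^ (N + 2))
      (fun z ↦ by have := regInv_nonneg 1 z; positivity)
      (by rw [integral_const_mul, integral_regInv_one_pow, inv_mul_cancel₀ hVpos.ne']) ?_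
      hg₁i hg₁c
    · have h2 := (h.comp tendsto_inv_nhdsGT_zero).const_mul V
      rw [hg₁x] at h2
      refine h2.congr' ?_
      filter_upwards [self_mem_nhdsWithin] with ε hε
      have hε : 0 < ε := hε
      simp only [Function.comp_apply]
      rw [← integral_const_mul]
      refine integral_congr_ae (.of_forall fun y ↦ ?_)
      have e : regInv 1 (ε⁻¹ • (x - y)) = ε * regInv ε (y - x) := by
        have : regInv ε (y - x) = regInv ε (x - y) := by simp only [regInv, norm_sub_rev]
        rw [this, regInv_eq_inv_mul hε, mul_inv_cancel_left₀ hε.ne']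
      simp only [smul_eq_mul, e, ← hNdef, mul_pow, inv_pow]
      rw [pow_add ε]
      field_simp
    · have hlim : Tendsto (fun z : E ↦ V⁻¹ * ‖z‖⁻¹ ^ 2) (Bornology.cobounded E) (𝓝 0) := by
        simpa using ((tendsto_inv_atTop_zero.comp tendsto_norm_cobounded_atTop).pow 2).const_mul V⁻¹
      refine squeeze_zero' (.of_forall fun z ↦ ?_) ?_ hlim
      · have := regInv_nonneg 1 z; positivity
      · filter_upwards [tendsto_norm_cobounded_atTop.eventually_gt_atTop 0] with z hz
        have h0 := regInv_nonneg 1 z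
        have h1 := norm_mul_regInv_le_one 1 z
        have h2 := regInv_le_inv_norm (norm_pos_iff.1 hz) 1
        calc ‖z‖ ^ N * (V⁻¹ * regInv 1 z ^ (N + 2))
            = V⁻¹ * ((‖z‖ * regInv 1 z) ^ N * regInv 1 z ^ 2) := by ring
          _ ≤ V⁻¹ * (1 ^ N * ‖z‖⁻¹ ^ 2) := by gcongr
          _ = _ := by ring
  -- the contribution of the complement of a ball around `x` is of order `ε ^ 2`
  set A := (1 + ‖x‖) / δ + 1 with hA
  have hfar_bd : ∀ ε > 0, ∀ y ≠ 0, |g₂ y * (ε ^ 2 * regInv ε (y - x) ^ (N + 2))| ≤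
      ε ^ 2 * (C * A ^ N * δ⁻¹ ^ 2 * (‖y‖⁻¹ * ((1 + ‖y‖) ^ N)⁻¹)) := fun ε hε y hy ↦ by
    by_cases hyb : y ∈ ball x δ
    · rw [hg₂, indicator_of_notMem (by simpa using hyb), zero_mul, abs_zero]
      positivity
    rw [hg₂, indicator_of_mem hyb]
    rw [mem_ball, dist_eq_norm, not_lt] at hyb
    have hz : 0 < ‖y - x‖ := hδ0.trans_le hyb
    have h0 := regInv_nonneg ε (y - x)
    have h1 := regInv_le_inv_norm (norm_pos_iff.1 hz) ε
    have h2 : ‖y - x‖⁻¹ ≤ A * (1 + ‖y‖)⁻¹ := by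
      rw [← div_eq_mul_inv, le_div_iff₀ (by positivity)]
      have h3 : ‖y‖ ≤ ‖x‖ + ‖y - x‖ := by simpa using norm_add_le x (y - x)
      calc ‖y - x‖⁻¹ * (1 + ‖y‖) ≤ ‖y - x‖⁻¹ * (1 + (‖x‖ + ‖y - x‖)) := by gcongr
        _ = (1 + ‖x‖) / ‖y - x‖ + 1 := by field_simp; ring
        _ ≤ A := by rw [hA]; gcongr
    rw [abs_mul, abs_of_nonneg (by positivity : 0 ≤ ε ^ 2 * regInv ε (y - x) ^ (N + 2)), pow_add]
    calc _ ≤ (C * ‖y‖⁻¹) * (ε ^ 2 * ((A * (1 + ‖y‖)⁻¹) ^ N * δ⁻¹ ^ 2)) := by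
          gcongr
          · exact hC y hy
          · exact h1.trans h2
          · exact h1.trans (by gcongr)
      _ = _ := by rw [mul_pow, inv_pow (1 + ‖y‖)]; ring
  have hJ := (integrable_inv_norm_mul_inv_one_add_norm_pow μ hN).const_mul (C * A ^ N * δ⁻¹ ^ 2)
  have hKc : ∀ ε > 0, Continuous fun y ↦ ε ^ 2 * regInv ε (y - x) ^ (N + 2) := fun ε hε ↦ by
    have := continuous_regInv (E := E) hε
    fun_prop
  have hg₂m : AEStronglyMeasurable g₂ μ := hgm.indicator measurableSet_ball.compl
  have hfar_int : ∀ ε > 0, Integrable (fun y ↦ g₂ y * (ε ^ 2 * regInv ε (y - x) ^ (N + 2))) μ :=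
    fun ε hε ↦ (hJ.const_mul (ε ^ 2)).mono' (hg₂m.mul (hKc ε hε).aestronglyMeasurable) (by
      filter_upwards [hne] with y hy using hfar_bd ε hε y hy)
  have hfar : Tendsto (fun ε ↦ ∫ y, g₂ y * (ε ^ 2 * regInv ε (y - x) ^ (N + 2)) ∂μ) (𝓝[>] 0)
      (𝓝 0) := by
    have hlim : Tendsto (fun ε : ℝ ↦ ε ^ 2 *
        ∫ y, C * A ^ N * δ⁻¹ ^ 2 * (‖y‖⁻¹ * ((1 + ‖y‖) ^ N)⁻¹) ∂μ) (𝓝[>] 0) (𝓝 0) := by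
      refine Tendsto.mono_left ?_ nhdsWithin_le_nhds
      have := ((continuous_pow 2).tendsto (0 : ℝ)).mul_const
        (∫ y, C * A ^ N * δ⁻¹ ^ 2 * (‖y‖⁻¹ * ((1 + ‖y‖) ^ N)⁻¹) ∂μ)
      simpa using this
    refine squeeze_zero_norm' ?_ hlim
    filter_upwards [self_mem_nhdsWithin] with ε hε
    rw [← integral_const_mul]
    refine norm_integral_le_of_norm_le (hJ.const_mul _) ?_
    filter_upwards [hne] with y hy using hfar_bd ε hε y hy
  have := hnear.add hfar
  rw [add_zero] at this
  refine this.congr' ?_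
  filter_upwards [self_mem_nhdsWithin] with ε hε
  have hε : 0 < ε := hε
  rw [← integral_add _ (hfar_int ε hε)]
  · simp only [← add_mul, ← hg12]
  · refine hg₁i.mul_bdd (c := 1 * ε⁻¹ ^ N) (hKc ε hε).aestronglyMeasurable (.of_forall fun y ↦ ?_)
    have h0 := regInv_nonneg ε (y - x)
    have h1 := mul_regInv_le_one ε (y - x)
    rw [Real.norm_of_nonneg (by positivity)]
    have h2 : regInv ε (y - x) ≤ ε⁻¹ := by rwa [← one_div, le_div_iff₀' hε]
    calc ε ^ 2 * regInv ε (y - x) ^ (N + 2)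
        = (ε * regInv ε (y - x)) ^ 2 * regInv ε (y - x) ^ N := by ring
      _ ≤ 1 ^ 2 * ε⁻¹ ^ N := by gcongr
      _ = _ := by ring

/-- If `W` is homogeneous of degree one and `C²` off the origin, its second derivatives at `x` are the
singular integral of its Laplacian `F` against the second derivatives of the Newtonian potential. As
`F` is continuous off the origin, the integrability hypothesis forces `F x = 0`; for other `F` a
multiple of `F x` would appear. -/
theorem hessian_eq_integral {μ : Measure E} [μ.IsAddHaarMeasure]
    (hN : 2 ≤ finrank ℝ E) (hW : ContDiffOn ℝ 2 W {0}ᶜ)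
    (hhom : ∀ c : ℝ, 0 < c → ∀ y, W (c • y) = c * W y) {ι : Type*} [Fintype ι]
    (e : OrthonormalBasis ι ℝ E) {x : E} (hx : x ≠ 0) (ξ : E) {F : E → ℝ}
    (hF : ∀ y ≠ 0, ∑ i, fderiv ℝ (fderiv ℝ W) y (e i) (e i) = F y)
    (hint : Integrable (fun y ↦ F y * (‖y - x‖ ^ finrank ℝ E)⁻¹) μ) :
    finrank ℝ E * μ.real (ball 0 1) * fderiv ℝ (fderiv ℝ W) x ξ ξ =
      ∫ y, F y * regKernel (finrank ℝ E) 0 ξ ξ (y - x) ∂μ := by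
  have : Nontrivial E := Module.nontrivial_of_finrank_pos (R := ℝ) (by omega)
  have hne : ∀ z : E, ∀ᵐ y ∂μ, y ≠ z := fun z ↦ by simp [ae_iff, measure_singleton]
  obtain ⟨C, hC0, hC⟩ := exists_bound_hessian_of_homogeneous hW hhom
  have hl := (tendsto_integral_mul_regInv (μ := μ) hN hx (g := fun y ↦ fderiv ℝ (fderiv ℝ W) y ξ ξ)
    (((continuousOn_hessian_compl_zero hW).clm_apply continuousOn_const).clm_apply
        continuousOn_const) (C := C * (‖ξ‖ * ‖ξ‖)) fun y hy ↦ by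
      refine (abs_apply_apply_le _ _ _).trans ?_
      rw [mul_right_comm]
      gcongr
      exact hC y hy).const_mul (finrank ℝ E : ℝ)
  have hFm : AEStronglyMeasurable F μ := by
    have h : AEStronglyMeasurable (fun y ↦ (F y * (‖y - x‖ ^ finrank ℝ E)⁻¹) *
        ‖y - x‖ ^ finrank ℝ E) μ :=
      hint.aestronglyMeasurable.mul (by fun_prop : Continuous _).aestronglyMeasurable
    refine h.congr ?_
    filter_upwards [hne x] with y hy
    have : ‖y - x‖ ≠ 0 := norm_ne_zero_iff.2 (sub_ne_zero.2 hy)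
    field_simp
  have hr : Tendsto (fun ε ↦ ∫ y, F y * regKernel (finrank ℝ E) ε ξ ξ (y - x) ∂μ) (𝓝[>] 0)
      (𝓝 (∫ y, F y * regKernel (finrank ℝ E) 0 ξ ξ (y - x) ∂μ)) := by
    refine tendsto_integral_filter_of_dominated_convergence
      (fun y ↦ (1 + finrank ℝ E) * (‖ξ‖ * ‖ξ‖) * ‖F y * (‖y - x‖ ^ finrank ℝ E)⁻¹‖) ?_ ?_
      (hint.norm.const_mul _) ?_
    · filter_upwards [self_mem_nhdsWithin] with ε hε
      exact hFm.mul ((continuous_regKernel _ hε ξ ξ).comp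
        (continuous_sub_right x)).aestronglyMeasurable
    · filter_upwards with ε
      filter_upwards [hne x] with y hy
      have hr := regInv_le_inv_norm (sub_ne_zero.2 hy) ε
      have h0 := regInv_nonneg ε (y - x)
      rw [norm_mul, norm_mul, norm_inv, norm_pow, norm_norm, mul_left_comm]
      gcongr
      refine (abs_regKernel_le _ _ _ _ _).trans ?_
      rw [← inv_pow]
      gcongr
    · filter_upwards [hne x] with y hy
      exact ((tendsto_regKernel ξ ξ (sub_ne_zero.2 hy)).mono_left nhdsWithin_le_nhds).const_mul _
  rw [mul_assoc]
  -- both limits are taken of the same integrals, by `integral_hessian_mul_regInv`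
  refine tendsto_nhds_unique (hl.congr' ?_) hr
  filter_upwards [self_mem_nhdsWithin] with ε hε
  have h := integral_hessian_mul_regInv (μ := μ) hN hW hhom e hε x ξ
  rw [← integral_const_mul]
  calc _ = _ := by
        refine integral_congr_ae (.of_forall fun y ↦ ?_)
        simp only
        ring
    _ = _ := h
    _ = _ := by
        refine integral_congr_ae ?_
        filter_upwards [hne 0] with y hy
        rw [hF y hy]

end Representation

/-! ### Homogeneous extensions of functions on the sphere -/

section SphereFunctions

open Module Filter Topology

variable {n : ℕ}

theorem homExt_of_ne_zero (k : ℤ) (g : UnitSphere n → ℝ) {y : Ambient n} (hy : y ≠ 0) :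
    homExt k g y = ‖y‖ ^ k * g (radialProj y hy) := dif_neg hy

theorem radialProj_smul {c : ℝ} (hc : 0 < c) {y : Ambient n} (hy : y ≠ 0) (hcy : c • y ≠ 0) :
    radialProj (c • y) hcy = radialProj y hy := by
  apply Subtype.ext
  simp only [radialProj, norm_smul, Real.norm_of_nonneg hc.le, smul_smul]
  congr 1
  field_simp

theorem homExt_smul (k : ℤ) (g : UnitSphere n → ℝ) {c : ℝ} (hc : 0 < c) (y : Ambient n) :
    homExt k g (c • y) = c ^ k * homExt k g y := by
  rcases eq_or_ne y 0 with rfl | hy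
  · simp [homExt]
  have hcy : c • y ≠ 0 := smul_ne_zero hc.ne' hy
  rw [homExt_of_ne_zero k g hcy, homExt_of_ne_zero k g hy, radialProj_smul hc hy hcy, norm_smul,
    Real.norm_of_nonneg hc.le, mul_zpow, mul_assoc]

theorem unitSphere_ne_zero (x : UnitSphere n) : (x : Ambient n) ≠ 0 :=
  ne_zero_of_mem_unit_sphere x

theorem norm_unitSphere (x : UnitSphere n) : ‖(x : Ambient n)‖ = 1 := norm_eq_of_mem_sphere x

theorem radialProj_coe (x : UnitSphere n) : radialProj (x : Ambient n) (unitSphere_ne_zero x) = x :=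
  Subtype.ext (by simp [radialProj])

theorem homExt_coe (k : ℤ) (g : UnitSphere n → ℝ) (x : UnitSphere n) :
    homExt k g (x : Ambient n) = g x := by
  rw [homExt_of_ne_zero k g (unitSphere_ne_zero x), radialProj_coe, norm_unitSphere, one_zpow,
    one_mul]

theorem homExt_one_eq_norm_mul (g : UnitSphere n → ℝ) (y : Ambient n) :
    homExt 1 g y = ‖y‖ * homExt 0 g y := by
  rcases eq_or_ne y 0 with rfl | hy
  · simp [homExt]
  · simp [homExt_of_ne_zero _ g hy]

theorem norm_smul_radialProj {y : Ambient n} (hy : y ≠ 0) :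
    ‖y‖ • (radialProj y hy : Ambient n) = y :=
  smul_inv_smul₀ (norm_ne_zero_iff.2 hy) y

/-- The radial projection is smooth as a map from the open submanifold `{0}ᶜ` to the sphere. -/
theorem contDiffAt_homExt_zero {k : ℕ∞ω} {u : UnitSphere n → ℝ}
    (hu : ContMDiff (𝓡 n) 𝓘(ℝ, ℝ) k u) {y : Ambient n} (hy : y ≠ 0) :
    ContDiffAt ℝ k (homExt 0 u) y := by
  have : Fact (finrank ℝ (Ambient n) = n + 1) := ⟨finrank_euclideanSpace_fin⟩
  let s : TopologicalSpace.Opens (Ambient n) := ⟨{0}ᶜ, isOpen_compl_singleton⟩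
  have hg : ContMDiff 𝓘(ℝ, Ambient n) 𝓘(ℝ, Ambient n) k
      (fun y : s ↦ ‖(y : Ambient n)‖⁻¹ • (y : Ambient n)) := fun y ↦ by
    refine (contMDiffAt_subtype_iff (f := fun y : Ambient n ↦ ‖y‖⁻¹ • y)).2
      (ContDiffAt.contMDiffAt ?_)
    have hy : (y : Ambient n) ≠ 0 := y.2
    exact ((contDiffAt_norm ℝ hy).inv (norm_ne_zero_iff.2 hy)).smul contDiffAt_id
  have h := hu.comp (hg.codRestrict_sphere (n := n) fun y ↦ (radialProj (y : Ambient n) y.2).2)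
  have h2 := h ⟨y, hy⟩
  refine ((contMDiffAt_subtype_iff (f := homExt 0 u)).1 (h2.congr_of_eventuallyEq
    (.of_forall fun z ↦ ?_))).contDiffAt
  have hz : (z : Ambient n) ≠ 0 := z.2
  change homExt 0 u (z : Ambient n) = u (radialProj z hz)
  rw [homExt_of_ne_zero 0 u hz, zpow_zero, one_mul]

theorem contDiffOn_homExt_zero {k : ℕ∞ω} {u : UnitSphere n → ℝ}
    (hu : ContMDiff (𝓡 n) 𝓘(ℝ, ℝ) k u) : ContDiffOn ℝ k (homExt 0 u) {0}ᶜ :=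
  fun _ hy ↦ (contDiffAt_homExt_zero hu hy).contDiffWithinAt

theorem contDiffOn_homExt_one {k : ℕ∞ω} {u : UnitSphere n → ℝ}
    (hu : ContMDiff (𝓡 n) 𝓘(ℝ, ℝ) k u) : ContDiffOn ℝ k (homExt 1 u) {0}ᶜ := fun y hy ↦ by
  rw [show homExt 1 u = fun y ↦ ‖y‖ * homExt 0 u y from funext (homExt_one_eq_norm_mul u)]
  exact ((contDiffAt_norm ℝ hy).mul (contDiffAt_homExt_zero hu hy)).contDiffWithinAt

theorem homExt_one_smul (u : UnitSphere n → ℝ) (c : ℝ) (hc : 0 < c) (y : Ambient n) :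
    homExt 1 u (c • y) = c * homExt 1 u y := by
  rw [homExt_smul 1 u hc, zpow_one]

theorem hasFDerivAt_norm {y : Ambient n} (hy : y ≠ 0) :
    HasFDerivAt (fun y : Ambient n ↦ ‖y‖) (‖y‖⁻¹ • innerSL ℝ y) y := by
  have h := (hasStrictFDerivAt_norm_sq y).hasFDerivAt.sqrt (by simpa using hy)
  simp only [Real.sqrt_sq (norm_nonneg _)] at h
  convert! h using 1
  ext z
  simp
  ring

theorem fderiv_homExt_one_apply {u : UnitSphere n → ℝ} (hu : ContMDiff (𝓡 n) 𝓘(ℝ, ℝ) 2 u)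
    {y : Ambient n} (hy : y ≠ 0) (b : Ambient n) :
    fderiv ℝ (homExt 1 u) y b =
      ‖y‖⁻¹ * ⟪y, b⟫ * homExt 0 u y + ‖y‖ * fderiv ℝ (homExt 0 u) y b := by
  have h := (hasFDerivAt_norm hy).mul
    (hasFDerivAt_of_contDiffOn_compl_zero (contDiffOn_homExt_zero hu) hy)
  rw [show homExt 1 u = (fun y ↦ ‖y‖) * homExt 0 u from funext (homExt_one_eq_norm_mul u),
    HasFDerivAt.fderiv h]
  simp
  ring

/-- The product rule for `homExt 1 u = |y| * homExt 0 u`, on the unit sphere. -/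
theorem hessian_homExt_one {u : UnitSphere n → ℝ} (hu : ContMDiff (𝓡 n) 𝓘(ℝ, ℝ) 2 u)
    (x : UnitSphere n) (a b : Ambient n) :
    fderiv ℝ (fderiv ℝ (homExt 1 u)) x a b =
      fderiv ℝ (fderiv ℝ (homExt 0 u)) x a b
        + (⟪a, b⟫ - ⟪(x : Ambient n), a⟫ * ⟪(x : Ambient n), b⟫) * u x
        + ⟪(x : Ambient n), a⟫ * fderiv ℝ (homExt 0 u) x b
        + ⟪(x : Ambient n), b⟫ * fderiv ℝ (homExt 0 u) x a := by
  have hx := unitSphere_ne_zero x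
  have hnx := norm_unitSphere x
  have hV := contDiffOn_homExt_zero hu
  have h1 : HasFDerivAt (fun y ↦ fderiv ℝ (homExt 1 u) y b) _ (x : Ambient n) :=
    (hasFDerivAt_fderiv_of_contDiffOn_compl_zero (contDiffOn_homExt_one hu) hx).clm_apply
      (hasFDerivAt_const b (x : Ambient n))
  have hn := hasFDerivAt_norm hx
  have h2 := ((((hasDerivAt_inv (norm_ne_zero_iff.2 hx)).comp_hasFDerivAt _ hn).mul
    ((innerSL ℝ b).hasFDerivAt (x := (x : Ambient n)))).mul
      (hasFDerivAt_of_contDiffOn_compl_zero hV hx)).add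
    (hn.mul ((hasFDerivAt_fderiv_of_contDiffOn_compl_zero hV hx).clm_apply
      (hasFDerivAt_const b (x : Ambient n))))
  have h3 := h1.unique (h2.congr_of_eventuallyEq (by
    filter_upwards [isOpen_compl_singleton.mem_nhds hx] with y hy
    rw [fderiv_homExt_one_apply hu hy b]
    simp [real_inner_comm]))
  have h4 := DFunLike.congr_fun h3 a
  simp [hnx, homExt_coe, real_inner_comm] at h4
  simp only [real_inner_comm] at h4 ⊢
  rw [h4]
  ring

/-- Euler's identity in degree zero. -/
theorem fderiv_homExt_zero_self {u : UnitSphere n → ℝ} (hu : ContMDiff (𝓡 n) 𝓘(ℝ, ℝ) 2 u)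
    (x : UnitSphere n) : fderiv ℝ (homExt 0 u) x x = 0 := by
  have h := (hasFDerivAt_of_contDiffOn_compl_zero (contDiffOn_homExt_zero hu)
    (unitSphere_ne_zero x)).hasLineDerivAt (x : Ambient n)
  refine HasDerivAt.unique h ((hasDerivAt_const (0 : ℝ) (u x)).congr_of_eventuallyEq ?_)
  filter_upwards [lt_mem_nhds (show (-1 : ℝ) < 0 by norm_num)] with t ht
  have e : (x : Ambient n) + t • (x : Ambient n) = (1 + t) • (x : Ambient n) := by
    rw [add_smul, one_smul]
  rw [e, homExt_smul 0 u (by linarith), homExt_coe, zpow_zero, one_mul]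

theorem hessian_homExt_one_eq_sphereHessian {u : UnitSphere n → ℝ}
    (hu : ContMDiff (𝓡 n) 𝓘(ℝ, ℝ) 2 u) (x : UnitSphere n) {ξ : Ambient n}
    (hξ : ⟪(x : Ambient n), ξ⟫ = 0) :
    fderiv ℝ (fderiv ℝ (homExt 1 u)) x ξ ξ = sphereHessian u x ξ ξ + u x * ‖ξ‖ ^ 2 := by
  rw [hessian_homExt_one hu, hξ, sphereHessian, iteratedFDeriv_two_apply,
    real_inner_self_eq_norm_sq]
  simp
  ring

theorem sum_hessian_homExt_one {u : UnitSphere n → ℝ} (hu : ContMDiff (𝓡 n) 𝓘(ℝ, ℝ) 2 u)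
    {ι : Type*} [Fintype ι] (e : OrthonormalBasis ι ℝ (Ambient n)) (x : UnitSphere n) :
    ∑ i, fderiv ℝ (fderiv ℝ (homExt 1 u)) x (e i) (e i) = sphereLaplacian u x + n * u x := by
  have hcard : Fintype.card ι = n + 1 := by
    rw [← finrank_eq_card_basis e.toBasis, finrank_euclideanSpace_fin]
  have hx : ∑ i, ⟪(x : Ambient n), e i⟫ • e i = (x : Ambient n) := by
    simpa [real_inner_comm] using e.sum_repr' (x : Ambient n)
  have h1 : ∑ i, ⟪(x : Ambient n), e i⟫ * fderiv ℝ (homExt 0 u) x (e i) = 0 := by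
    rw [← fderiv_homExt_zero_self hu x]
    simpa using congrArg (fderiv ℝ (homExt 0 u) x) hx
  have h2 : ∑ i, ⟪(x : Ambient n), e i⟫ * ⟪(x : Ambient n), e i⟫ = 1 := by
    have := e.sum_inner_mul_inner (x : Ambient n) (x : Ambient n)
    rw [real_inner_self_eq_norm_sq, norm_unitSphere, one_pow] at this
    simpa only [real_inner_comm (x : Ambient n)] using this
  rw [sphereLaplacian, InnerProductSpace.laplacian_eq_iteratedFDeriv_orthonormalBasis _ e]
  simp only [hessian_homExt_one hu, iteratedFDeriv_two_apply, Finset.sum_add_distrib, h1,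
    ← Finset.sum_mul, Finset.sum_sub_distrib, h2, real_inner_self_eq_norm_sq, e.norm_eq_one]
  simp [hcard]

/-- The equation `Δ u + n u = f` on the sphere says that the Euclidean Laplacian of the extension of
`u` of degree one is the extension of `f` of degree minus one. -/
theorem sum_hessian_homExt_one_eq_homExt {f u : UnitSphere n → ℝ} (h : IsSphereSolution f u)
    {ι : Type*} [Fintype ι] (e : OrthonormalBasis ι ℝ (Ambient n)) {y : Ambient n} (hy : y ≠ 0) :
    ∑ i, fderiv ℝ (fderiv ℝ (homExt 1 u)) y (e i) (e i) = homExt (-1) f y := by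
  have hn : 0 < ‖y‖ := norm_pos_iff.2 hy
  rw [homExt_of_ne_zero _ f hy, ← h.2, ← sum_hessian_homExt_one h.1 e, Finset.mul_sum]
  refine Finset.sum_congr rfl fun i _ ↦ ?_
  conv_lhs => rw [← norm_smul_radialProj hy, hessian_smul_of_homogeneous (homExt_one_smul u) hn]
  rw [zpow_neg_one]
  rfl

theorem hessian_homExt_zero_sub_const (u : UnitSphere n → ℝ) (c : ℝ) (x : UnitSphere n) :
    fderiv ℝ (fderiv ℝ (homExt 0 fun z ↦ u z - c)) x =
      fderiv ℝ (fderiv ℝ (homExt 0 u)) (x : Ambient n) := by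
  have h : homExt 0 (fun z ↦ u z - c) =ᶠ[𝓝 (x : Ambient n)] fun y ↦ homExt 0 u y - c := by
    filter_upwards [isOpen_compl_singleton.mem_nhds (unitSphere_ne_zero x)] with y hy
    simp [homExt_of_ne_zero 0 _ hy]
  rw [h.fderiv.fderiv_eq]
  congr 1
  ext1 y
  exact fderiv_sub_const c

/-- Subtracting `f x / n` from the solution reduces to a right-hand side that vanishes at `x`. -/
theorem IsSphereSolution.sub_const {f u : UnitSphere n → ℝ} (h : IsSphereSolution f u) (c : ℝ) :
    IsSphereSolution (fun x ↦ f x - n * c) fun x ↦ u x - c := by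
  refine ⟨h.1.sub contMDiff_const, fun x ↦ ?_⟩
  have e := EuclideanSpace.basisFun (Fin (n + 1)) ℝ
  have := h.2 x
  rw [sphereLaplacian, InnerProductSpace.laplacian_eq_iteratedFDeriv_orthonormalBasis _ e] at this ⊢
  simp only [iteratedFDeriv_two_apply, hessian_homExt_zero_sub_const] at this ⊢
  linarith

end SphereFunctions

/-! ### Convexity and the Hessian -/

section Convexity

open Module Filter Topology

theorem hasDerivAt_comp_line {E F : Type*} [NormedAddCommGroup E] [NormedSpace ℝ E]
    [NormedAddCommGroup F] [NormedSpace ℝ F] {G : E → F} {G' : E →L[ℝ] F} {p v : E} {t : ℝ}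
    (h : HasFDerivAt G G' (p + t • v)) : HasDerivAt (fun s : ℝ ↦ G (p + s • v)) (G' v) t := by
  have h1 : HasDerivAt (fun s : ℝ ↦ p + s • v) ((1 : ℝ) • v) t :=
    ((hasDerivAt_id t).smul_const v).const_add p
  rw [one_smul] at h1
  exact h.comp_hasDerivAt t h1

variable {E : Type*} [NormedAddCommGroup E] [NormedSpace ℝ E] {W : E → ℝ}

theorem convexOn_line_of_hessian_nonneg (hW : ContDiffOn ℝ 2 W {0}ᶜ)
    (hH : ∀ y ≠ 0, ∀ v, 0 ≤ fderiv ℝ (fderiv ℝ W) y v v) {p v : E} (hp : ∀ t : ℝ, p + t • v ≠ 0) :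
    ConvexOn ℝ univ fun t : ℝ ↦ W (p + t • v) := by
  have h1 : ∀ t : ℝ, HasDerivAt (fun t : ℝ ↦ W (p + t • v)) (fderiv ℝ W (p + t • v) v) t :=
    fun t ↦ hasDerivAt_comp_line (hasFDerivAt_of_contDiffOn_compl_zero hW (hp t))
  have h2 : ∀ t : ℝ, HasDerivAt (fun t : ℝ ↦ fderiv ℝ W (p + t • v) v)
      (fderiv ℝ (fderiv ℝ W) (p + t • v) v v) t := fun t ↦ by
    simpa using (hasDerivAt_comp_line (hasFDerivAt_fderiv_of_contDiffOn_compl_zero hW (hp t))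
      ).clm_apply (hasDerivAt_const t v)
  have e1 : deriv (fun t : ℝ ↦ W (p + t • v)) = fun t : ℝ ↦ fderiv ℝ W (p + t • v) v :=
    funext fun t ↦ (h1 t).deriv
  refine convexOn_univ_of_deriv2_nonneg (fun t ↦ (h1 t).differentiableAt) ?_ fun t ↦ ?_
  · rw [e1]; exact fun t ↦ (h2 t).differentiableAt
  · rw [Function.iterate_succ, Function.iterate_one, Function.comp_apply, e1, (h2 t).deriv]
    exact hH _ (hp t) v

theorem hessian_nonneg_of_convexOn (hW : ContDiffOn ℝ 2 W {0}ᶜ) (hc : ConvexOn ℝ univ W)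
    {p v : E} (hp : ∀ t : ℝ, p + t • v ≠ 0) : 0 ≤ fderiv ℝ (fderiv ℝ W) p v v := by
  have h1 : ∀ t : ℝ, HasDerivAt (fun t : ℝ ↦ W (p + t • v)) (fderiv ℝ W (p + t • v) v) t :=
    fun t ↦ hasDerivAt_comp_line (hasFDerivAt_of_contDiffOn_compl_zero hW (hp t))
  have h2 : HasDerivAt (fun t : ℝ ↦ fderiv ℝ W (p + t • v) v)
      (fderiv ℝ (fderiv ℝ W) (p + (0 : ℝ) • v) v v) 0 := by
    simpa using (hasDerivAt_comp_line (hasFDerivAt_fderiv_of_contDiffOn_compl_zero hW (hp 0))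
      ).clm_apply (hasDerivAt_const (0 : ℝ) v)
  have hcl : ConvexOn ℝ univ fun t : ℝ ↦ W (p + t • v) := by
    refine ⟨convex_univ, fun s _ t _ a b ha hb hab ↦ ?_⟩
    have := hc.2 (mem_univ (p + s • v)) (mem_univ (p + t • v)) ha hb hab
    have e : a • (p + s • v) + b • (p + t • v) = p + (a • s + b • t) • v := by
      rw [eq_sub_of_add_eq hab]
      module
    rwa [e] at this
  have e1 : deriv (fun t : ℝ ↦ W (p + t • v)) = fun t : ℝ ↦ fderiv ℝ W (p + t • v) v :=
    funext fun t ↦ (h1 t).deriv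
  have hm : Monotone fun t : ℝ ↦ fderiv ℝ W (p + t • v) v := by
    rw [← e1, ← monotoneOn_univ]
    exact hcl.monotoneOn_deriv fun t _ ↦ (h1 t).differentiableAt
  have := hm.deriv_nonneg (x := 0)
  rwa [h2.deriv, zero_smul, add_zero] at this

/-- Lines through the origin, where `W` need not be differentiable, are limits of lines that avoid it:
two points `p`, `q` are displaced in a direction orthogonal to both, which exists in dimension three
and above. -/
theorem convexOn_of_hessian_nonneg {E : Type*} [NormedAddCommGroup E] [InnerProductSpace ℝ E]
    [FiniteDimensional ℝ E] {W : E → ℝ} (hdim : 3 ≤ finrank ℝ E) (hWc : Continuous W)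
    (hW : ContDiffOn ℝ 2 W {0}ᶜ) (hH : ∀ y ≠ 0, ∀ v, 0 ≤ fderiv ℝ (fderiv ℝ W) y v v) :
    ConvexOn ℝ univ W := by
  classical
  refine ⟨convex_univ, fun p _ q _ a b ha hb hab ↦ ?_⟩
  obtain ⟨e, he, he0⟩ : ∃ e ∈ (Submodule.span ℝ (({p, q} : Finset E) : Set E))ᗮ, e ≠ 0 := by
    refine Submodule.exists_mem_ne_zero_of_ne_bot fun hbot ↦ ?_
    have h1 := Submodule.finrank_add_finrank_orthogonal
      (Submodule.span ℝ (({p, q} : Finset E) : Set E))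
    have h2 := finrank_span_finset_le_card (R := ℝ) ({p, q} : Finset E)
    have h3 : ({p, q} : Finset E).card ≤ 2 := Finset.card_le_two
    rw [hbot, finrank_bot] at h1
    have h4 : (({p, q} : Finset E) : Set E).finrank ℝ =
      finrank ℝ (Submodule.span ℝ (({p, q} : Finset E) : Set E)) := rfl
    omega
  have hpe : ⟪e, p⟫ = 0 := by
    rw [real_inner_comm]
    exact (Submodule.mem_orthogonal _ _).1 he p (Submodule.subset_span (by simp))
  have hqe : ⟪e, q⟫ = 0 := by
    rw [real_inner_comm]
    exact (Submodule.mem_orthogonal _ _).1 he q (Submodule.subset_span (by simp))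
  have key : ∀ s : ℝ, s ∈ Ioi 0 →
      W (a • p + b • q + s • e) ≤ a • W (p + s • e) + b • W (q + s • e) := fun s hs ↦ by
    have hs : 0 < s := hs
    have hc := convexOn_line_of_hessian_nonneg hW hH (p := p + s • e) (v := q - p) fun t h ↦ by
      have := congrArg (fun z ↦ ⟪e, z⟫) h
      simp [inner_add_right, inner_sub_right, inner_smul_right, hpe, hqe, hs.ne', he0] at this
    have := hc.2 (mem_univ 0) (mem_univ 1) ha hb hab
    have e1 : p + s • e + (a • 0 + b • 1 : ℝ) • (q - p) = a • p + b • q + s • e := by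
      rw [eq_sub_of_add_eq hab]
      module
    have e2 : p + s • e + (1 : ℝ) • (q - p) = q + s • e := by module
    beta_reduce at this
    rwa [e1, e2, zero_smul, add_zero] at this
  have hl : Tendsto (fun s : ℝ ↦ W (a • p + b • q + s • e)) (𝓝[>] 0) (𝓝 (W (a • p + b • q))) := by
    have : Continuous fun s : ℝ ↦ W (a • p + b • q + s • e) := by fun_prop
    simpa using (this.tendsto 0).mono_left nhdsWithin_le_nhds
  have hr : Tendsto (fun s : ℝ ↦ a • W (p + s • e) + b • W (q + s • e)) (𝓝[>] 0)
      (𝓝 (a • W p + b • W q)) := by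
    have : Continuous fun s : ℝ ↦ a • W (p + s • e) + b • W (q + s • e) := by fun_prop
    simpa using (this.tendsto 0).mono_left nhdsWithin_le_nhds
  exact le_of_tendsto_of_tendsto hl hr (eventually_of_mem self_mem_nhdsWithin key)

variable {n : ℕ}

theorem continuous_homExt_one {u : UnitSphere n → ℝ} (hu : Continuous u)
    (h : ContinuousOn (homExt 1 u) {0}ᶜ) : Continuous (homExt 1 u) := by
  refine continuous_iff_continuousAt.2 fun y ↦ ?_
  rcases eq_or_ne y 0 with rfl | hy
  · obtain ⟨C, hC⟩ := (isCompact_univ (X := UnitSphere n)).exists_bound_of_continuousOn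
      hu.continuousOn
    have h0 : homExt 1 u (0 : Ambient n) = 0 := by simp [homExt]
    rw [ContinuousAt, h0]
    have hl : Tendsto (fun y : Ambient n ↦ ‖y‖ * C) (𝓝 0) (𝓝 0) := by
      simpa using (continuous_norm.tendsto (0 : Ambient n)).mul_const C
    refine squeeze_zero_norm' ?_ hl
    refine .of_forall fun y ↦ ?_
    rcases eq_or_ne y 0 with rfl | hy
    · simp [h0]
    · rw [homExt_of_ne_zero _ _ hy, norm_mul, zpow_one, norm_norm]
      gcongr
      exact hC _ (mem_univ _)
  · exact h.continuousAt (isOpen_compl_singleton.mem_nhds hy)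

/-- Euler's identity for the gradient, which is homogeneous of degree zero. -/
theorem hessian_apply_self_of_homogeneous (hW : ContDiffOn ℝ 2 W {0}ᶜ)
    (hhom : ∀ c : ℝ, 0 < c → ∀ y, W (c • y) = c * W y) {x : E} (hx : x ≠ 0) :
    fderiv ℝ (fderiv ℝ W) x x = 0 := by
  have h := (hasFDerivAt_fderiv_of_contDiffOn_compl_zero hW hx).hasLineDerivAt x
  refine HasDerivAt.unique h
    ((hasDerivAt_const (0 : ℝ) (fderiv ℝ W x)).congr_of_eventuallyEq ?_)
  filter_upwards [lt_mem_nhds (show (-1 : ℝ) < 0 by norm_num)] with t ht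
  have e : x + t • x = (1 + t) • x := by rw [add_smul, one_smul]
  rw [e, fderiv_smul_of_homogeneous hhom (by linarith)]

theorem isConvexOnSphere_iff_hessianFormNonneg (hn : 2 ≤ n) {u : UnitSphere n → ℝ}
    (hu : ContMDiff (𝓡 n) 𝓘(ℝ, ℝ) 2 u) : IsConvexOnSphere u ↔ HessianFormNonneg u := by
  have hW := contDiffOn_homExt_one hu
  constructor
  · intro hc x ξ hξ
    rw [← hessian_homExt_one_eq_sphereHessian hu x hξ]
    refine hessian_nonneg_of_convexOn hW hc fun t h ↦ ?_
    have := congrArg (fun z ↦ ⟪(x : Ambient n), z⟫) h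
    simp [inner_add_right, inner_smul_right, hξ] at this
  · intro hH
    refine convexOn_of_hessian_nonneg (by simp; omega)
      (continuous_homExt_one hu.continuous hW.continuousOn) hW fun y hy v ↦ ?_
    have hy0 : 0 < ‖y‖ := norm_pos_iff.2 hy
    obtain ⟨x, hxy⟩ : ∃ x, x = radialProj y hy := ⟨_, rfl⟩
    have hx := unitSphere_ne_zero x
    rw [← norm_smul_radialProj hy, ← hxy, hessian_smul_of_homogeneous (homExt_one_smul u) hy0]
    refine mul_nonneg (by positivity) ?_
    -- the radial component of `v` lies in the kernel of the Hessian
    set c := ⟪(x : Ambient n), v⟫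
    set ξ := v - c • (x : Ambient n)
    have hξ : ⟪(x : Ambient n), ξ⟫ = 0 := by
      simp [ξ, c, inner_sub_right, inner_smul_right]
    have hv : v = ξ + c • (x : Ambient n) := by simp [ξ]
    have h0 := hessian_apply_self_of_homogeneous hW (homExt_one_smul u) hx
    have h1 : fderiv ℝ (fderiv ℝ (homExt 1 u)) x ξ x = 0 := by
      rw [hessian_symm_of_contDiffOn_compl_zero hW hx, h0]
      rfl
    have h2 := hH x ξ hξ
    rw [← hessian_homExt_one_eq_sphereHessian hu x hξ] at h2
    rw [hv]
    simpa [h0, h1] using h2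

end Convexity

/-! ### The integral criterion -/

section Criterion

open Module Filter Topology

/-- The Hölder-type bound controls the singularity at `x`, the bound by `M / |y|` the origin and
infinity. -/
theorem integrable_mul_inv_norm_sub_pow {E : Type*} [NormedAddCommGroup E] [InnerProductSpace ℝ E]
    [FiniteDimensional ℝ E] [MeasurableSpace E] [BorelSpace E] {μ : Measure E}
    [μ.IsAddHaarMeasure] (hN : 2 ≤ finrank ℝ E) {x : E} (hx : x ≠ 0) {F : E → ℝ}
    (hF : ContinuousOn F {0}ᶜ) {M C s : ℝ} (hs : 0 < s) (hM : ∀ y ≠ 0, |F y| ≤ M * ‖y‖⁻¹)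
    (hC : ∀ y ≠ 0, |F y| ≤ C * ‖y‖⁻¹ * ‖y - x‖ ^ s) :
    Integrable (fun y ↦ F y * (‖y - x‖ ^ finrank ℝ E)⁻¹) μ := by
  have : Nontrivial E := Module.nontrivial_of_finrank_pos (R := ℝ) (by omega)
  have hne : ∀ z : E, ∀ᵐ y ∂μ, y ≠ z := fun z ↦ by simp [ae_iff, measure_singleton]
  set N := finrank ℝ E with hNdef
  have hxn : 0 < ‖x‖ := norm_pos_iff.2 hx
  set δ := ‖x‖ / 2 with hδ
  have hδ0 : 0 < δ := by positivity
  have hM0 : 0 ≤ M := nonneg_of_mul_nonneg_left ((abs_nonneg _).trans (hM x hx)) (by positivity)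
  have hC0 : 0 ≤ C := by
    -- the bound at `2 x` shows that `C` is nonnegative
    have h2 : (2 : ℝ) • x - x = x := by module
    have h := (abs_nonneg _).trans (hC ((2 : ℝ) • x) (smul_ne_zero two_ne_zero hx))
    rw [mul_assoc, h2] at h
    exact nonneg_of_mul_nonneg_left h (by rw [norm_smul, Real.norm_two]; positivity)
  have hm : AEStronglyMeasurable (fun y ↦ F y * (‖y - x‖ ^ N)⁻¹) μ :=
    (aestronglyMeasurable_of_continuousOn_compl_zero hF).mul
      (by fun_prop : Measurable fun y : E ↦ (‖y - x‖ ^ N)⁻¹).aestronglyMeasurable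
  set A := (1 + ‖x‖) / δ + 1 with hA
  have hnear : Integrable (fun y ↦ (ball (0 : E) δ).indicator
      (fun z ↦ ‖z‖ ^ (s - N)) (y - x)) μ :=
    ((integrable_indicator_iff measurableSet_ball).2
      (integrableOn_ball_norm_rpow μ (by linarith) δ)).comp_sub_right x
  refine ((hnear.const_mul (C * δ⁻¹)).add ((integrable_inv_norm_mul_inv_one_add_norm_pow μ hN
    ).const_mul (M * A ^ N))).mono' hm ?_
  filter_upwards [hne 0, hne x] with y hy hyx
  have hz : 0 < ‖y - x‖ := norm_pos_iff.2 (sub_ne_zero.2 hyx)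
  have hi : 0 ≤ (ball (0 : E) δ).indicator (fun z ↦ ‖z‖ ^ (s - N)) (y - x) :=
    indicator_nonneg (fun z _ ↦ by positivity) _
  simp only [Pi.add_apply]
  rw [norm_mul, Real.norm_eq_abs, Real.norm_of_nonneg (by positivity)]
  by_cases hyb : y - x ∈ ball (0 : E) δ
  · refine le_add_of_le_of_nonneg ?_ (by positivity)
    rw [indicator_of_mem hyb, Real.rpow_sub hz, Real.rpow_natCast]
    rw [mem_ball_zero_iff] at hyb
    have h1 : δ ≤ ‖y‖ := by
      have := norm_sub_norm_le x (x - y)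
      rw [sub_sub_cancel, norm_sub_rev] at this
      linarith
    calc |F y| * (‖y - x‖ ^ N)⁻¹ ≤ C * δ⁻¹ * ‖y - x‖ ^ s * (‖y - x‖ ^ N)⁻¹ := by
          gcongr
          refine (hC y hy).trans ?_
          gcongr
      _ = _ := by ring
  · refine le_add_of_nonneg_of_le (by positivity) ?_
    rw [mem_ball_zero_iff, not_lt] at hyb
    have h2 : ‖y - x‖⁻¹ ≤ A * (1 + ‖y‖)⁻¹ := by
      rw [← div_eq_mul_inv, le_div_iff₀ (by positivity)]
      have h3 : ‖y‖ ≤ ‖x‖ + ‖y - x‖ := by simpa using norm_add_le x (y - x)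
      calc ‖y - x‖⁻¹ * (1 + ‖y‖) ≤ ‖y - x‖⁻¹ * (1 + (‖x‖ + ‖y - x‖)) := by gcongr
        _ = (1 + ‖x‖) / ‖y - x‖ + 1 := by field_simp; ring
        _ ≤ A := by rw [hA]; gcongr
    calc |F y| * (‖y - x‖ ^ N)⁻¹ ≤ M * ‖y‖⁻¹ * (A * (1 + ‖y‖)⁻¹) ^ N := by
          rw [← inv_pow]
          gcongr
          exact hM y hy
      _ = _ := by rw [mul_pow, inv_pow]; ring

variable {n : ℕ}

theorem continuousOn_homExt {k : ℤ} {g : UnitSphere n → ℝ} (hg : Continuous g) :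
    ContinuousOn (homExt k g) {0}ᶜ := by
  rw [continuousOn_iff_continuous_domRestrict]
  have h1 : Continuous fun y : ({0}ᶜ : Set (Ambient n)) ↦ radialProj (y : Ambient n) y.2 :=
    Continuous.subtype_mk (.smul (.inv₀ (by fun_prop) fun y ↦ norm_ne_zero_iff.2 y.2)
      continuous_subtype_val) _
  have h2 : Continuous fun y : ({0}ᶜ : Set (Ambient n)) ↦ ‖(y : Ambient n)‖ ^ k :=
    Continuous.zpow₀ (by fun_prop) k fun y ↦ .inl (norm_ne_zero_iff.2 y.2)
  refine (h2.mul (hg.comp h1)).congr fun y ↦ ?_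
  exact (homExt_of_ne_zero k g y.2).symm

theorem norm_radialProj_sub_le (x : UnitSphere n) {y : Ambient n} (hy : y ≠ 0) :
    ‖(radialProj y hy : Ambient n) - x‖ ≤ 2 * ‖y - x‖ := by
  have hn : ‖y‖ ≠ 0 := norm_ne_zero_iff.2 hy
  have h1 : ‖(radialProj y hy : Ambient n) - y‖ ≤ ‖y - x‖ := by
    have e : (radialProj y hy : Ambient n) - y = (1 - ‖y‖) • (radialProj y hy : Ambient n) := by
      rw [sub_smul, one_smul, norm_smul_radialProj]
    rw [e, norm_smul, norm_unitSphere, mul_one, Real.norm_eq_abs, norm_sub_rev]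
    simpa only [norm_unitSphere] using abs_norm_sub_norm_le (x : Ambient n) y
  calc _ = ‖((radialProj y hy : Ambient n) - y) + (y - x)‖ := by rw [sub_add_sub_cancel]
    _ ≤ ‖y - x‖ + ‖y - x‖ := (norm_add_le _ _).trans (by gcongr)
    _ = _ := by ring

theorem homExt_neg_one_sub_const (f : UnitSphere n → ℝ) (c : ℝ) (y : Ambient n) :
    homExt (-1) (fun z ↦ f z - c) y = homExt (-1) f y - c / ‖y‖ := by
  rcases eq_or_ne y 0 with rfl | hy
  · simp [homExt]
  · rw [homExt_of_ne_zero _ _ hy, homExt_of_ne_zero _ _ hy, zpow_neg_one]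
    ring

theorem integrable_homExt_mul_inv_norm_sub_pow (hn : 1 ≤ n) {α : ℝ≥0} (hα : 0 < α)
    {f : UnitSphere n → ℝ} (hfα : ∃ C : ℝ≥0, HolderWith C α f) (x : UnitSphere n) :
    Integrable (fun y : Ambient n ↦ homExt (-1) (fun z ↦ f z - f x) y *
      (‖y - x‖ ^ finrank ℝ (Ambient n))⁻¹) := by
  obtain ⟨C, hC⟩ := hfα
  have hfc : Continuous f := hC.continuous hα
  have hgc : Continuous fun z ↦ f z - f x := hfc.sub continuous_const
  obtain ⟨M, hM⟩ := (isCompact_univ (X := UnitSphere n)).exists_bound_of_continuousOn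
    hgc.continuousOn
  refine integrable_mul_inv_norm_sub_pow (by simp; omega) (unitSphere_ne_zero x)
    (continuousOn_homExt hgc) (M := M) (C := C * 2 ^ (α : ℝ)) (s := α) (by exact_mod_cast hα)
    (fun y hy ↦ ?_) fun y hy ↦ ?_
  · rw [homExt_of_ne_zero _ _ hy, zpow_neg_one, abs_mul, abs_of_nonneg (by positivity), mul_comm]
    gcongr
    exact hM _ (mem_univ _)
  · rw [homExt_of_ne_zero _ _ hy, zpow_neg_one, abs_mul, abs_of_nonneg (by positivity)]
    have h1 : |f (radialProj y hy) - f x| ≤ C * (2 * ‖y - x‖) ^ (α : ℝ) := by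
      rw [← Real.dist_eq]
      refine (hC.dist_le _ _).trans ?_
      gcongr
      rw [Subtype.dist_eq, dist_eq_norm]
      exact norm_radialProj_sub_le x hy
    calc _ ≤ ‖y‖⁻¹ * (C * (2 * ‖y - x‖) ^ (α : ℝ)) := by gcongr
      _ = _ := by rw [Real.mul_rpow (by norm_num) (norm_nonneg _)]; ring

theorem criterionIntegrand_eq (f : UnitSphere n → ℝ) {x ξ : UnitSphere n}
    (hξ : ⟪(x : Ambient n), (ξ : Ambient n)⟫ = 0) {y : Ambient n} (hy : y ≠ x) :
    criterionIntegrand f x ξ y = homExt (-1) (fun z ↦ f z - f x) y *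
      regKernel (finrank ℝ (Ambient n)) 0 (ξ : Ambient n) ξ (y - x) := by
  have hz : ‖y - x‖ ≠ 0 := norm_ne_zero_iff.2 (sub_ne_zero.2 hy)
  rw [criterionIntegrand, homExt_neg_one_sub_const, mul_comm]
  congr 1
  rw [regKernel, regInv_zero, real_inner_self_eq_norm_sq, norm_unitSphere, inner_sub_right,
    real_inner_comm (x : Ambient n), hξ, norm_sub_rev, finrank_euclideanSpace_fin]
  push_cast
  simp only [inv_pow]
  field_simp
  ring

theorem integrable_criterionIntegrand (hn : 1 ≤ n) {α : ℝ≥0} (hα : 0 < α)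
    {f : UnitSphere n → ℝ} (hfα : ∃ C : ℝ≥0, HolderWith C α f) {x ξ : UnitSphere n}
    (hξ : ⟪(x : Ambient n), (ξ : Ambient n)⟫ = 0) :
    Integrable (criterionIntegrand f x ξ) volume := by
  have hF := integrable_homExt_mul_inv_norm_sub_pow hn hα hfα x
  have hne : ∀ᵐ y : Ambient n, y ≠ x := by simp [ae_iff, measure_singleton]
  have hfc : Continuous f := let ⟨C, hC⟩ := hfα; hC.continuous hα
  have hm : AEStronglyMeasurable (fun y : Ambient n ↦ homExt (-1) (fun z ↦ f z - f x) y *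
      regKernel (finrank ℝ (Ambient n)) 0 (ξ : Ambient n) ξ (y - x)) :=
    (aestronglyMeasurable_of_continuousOn_compl_zero
      (continuousOn_homExt (hfc.sub continuous_const))).mul
      (by unfold regKernel regInv; fun_prop : Measurable _).aestronglyMeasurable
  refine Integrable.congr ((hF.norm.const_mul (1 + finrank ℝ (Ambient n) : ℝ)).mono' hm ?_)
    (g := criterionIntegrand f x ξ) ?_
  · refine .of_forall fun y ↦ ?_
    have h := abs_regKernel_le (finrank ℝ (Ambient n)) 0 (ξ : Ambient n) ξ (y - x)
    rw [norm_unitSphere, mul_one, mul_one, regInv_zero, inv_pow] at h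
    rw [norm_mul, norm_mul, norm_inv, norm_pow, norm_norm, mul_left_comm]
    gcongr
    exact h
  · filter_upwards [hne] with y hy using (criterionIntegrand_eq f hξ hy).symm

theorem sphereArea_eq (n : ℕ) : sphereArea n =
    finrank ℝ (Ambient n) * (volume : Measure (Ambient n)).real (ball 0 1) :=
  Measure.toSphere_real_apply_univ _

/-- The integral in the criterion computes `∇² u (ξ, ξ) + u` for a solution `u`. -/
theorem sphereHessian_add_eq (hn : 1 ≤ n) {α : ℝ≥0} (hα : 0 < α) {f u : UnitSphere n → ℝ}
    (hfα : ∃ C : ℝ≥0, HolderWith C α f) (h : IsSphereSolution f u) {x ξ : UnitSphere n}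
    (hξ : ⟪(x : Ambient n), (ξ : Ambient n)⟫ = 0) :
    sphereHessian u x ξ ξ + u x =
      1 / sphereArea n * (∫ y, criterionIntegrand f x ξ y) + 1 / n * f x := by
  have hn0 : (n : ℝ) ≠ 0 := by positivity
  -- the shifted solution has a right-hand side that vanishes at `x`
  have hsol := h.sub_const (f x / n)
  have e1 : (n : ℝ) * (f x / n) = f x := by field_simp
  rw [e1] at hsol
  have e := EuclideanSpace.basisFun (Fin (n + 1)) ℝ
  have key := hessian_eq_integral (μ := (volume : Measure (Ambient n))) (by simp; omega)
    (contDiffOn_homExt_one hsol.1) (homExt_one_smul _) e (unitSphere_ne_zero x) (ξ : Ambient n)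
    (F := homExt (-1) fun z ↦ f z - f x)
    (fun y hy ↦ sum_hessian_homExt_one_eq_homExt hsol e hy)
    (integrable_homExt_mul_inv_norm_sub_pow hn hα hfα x)
  have hne : ∀ᵐ y : Ambient n, y ≠ x := by simp [ae_iff, measure_singleton]
  have hI : ∫ y, criterionIntegrand f x ξ y = ∫ y, homExt (-1) (fun z ↦ f z - f x) y *
      regKernel (finrank ℝ (Ambient n)) 0 (ξ : Ambient n) ξ (y - x) := by
    refine integral_congr_ae ?_
    filter_upwards [hne] with y hy using criterionIntegrand_eq f hξ hy
  have hpos : 0 < sphereArea n := by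
    rw [sphereArea_eq]
    refine mul_pos (by simp; positivity)
      (ENNReal.toReal_pos (measure_ball_pos _ _ one_pos).ne' measure_ball_lt_top.ne)
  rw [← hI, ← sphereArea_eq, hessian_homExt_one_eq_sphereHessian hsol.1 x hξ, sphereHessian,
    iteratedFDeriv_two_apply, hessian_homExt_zero_sub_const, ← iteratedFDeriv_two_apply,
    ← sphereHessian, norm_unitSphere] at key
  rw [← key]
  field_simp
  ring

theorem hessianFormNonneg_iff_forall_unit (u : UnitSphere n → ℝ) :
    HessianFormNonneg u ↔ ∀ x ξ : UnitSphere n, ⟪(x : Ambient n), (ξ : Ambient n)⟫ = 0 →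
      0 ≤ sphereHessian u x ξ ξ + u x := by
  constructor
  · intro h x ξ hξ
    simpa [norm_unitSphere] using h x ξ hξ
  · intro h x ξ hξ
    rcases eq_or_ne ξ 0 with rfl | h0
    · simp [sphereHessian, iteratedFDeriv_two_apply]
    have hn : ‖ξ‖ ≠ 0 := norm_ne_zero_iff.2 h0
    have h1 := h x (radialProj ξ h0) (by simp [radialProj, inner_smul_right, hξ])
    have h2 := mul_nonneg (sq_nonneg ‖ξ‖) h1
    have h3 : sphereHessian u x ξ ξ =
        ‖ξ‖ ^ 2 * sphereHessian u x (radialProj ξ h0) (radialProj ξ h0) := by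
      conv_lhs => rw [← norm_smul_radialProj h0]
      simp [sphereHessian, iteratedFDeriv_two_apply]
      ring
    rw [h3]
    linarith

theorem theorem3p1 (n : ℕ) (hn : 2 ≤ n) (α : ℝ≥0) (hα : 0 < α) (hα1 : α ≤ 1)
    (f : UnitSphere n → ℝ) (hfα : ∃ C : ℝ≥0, HolderWith C α f) (hfpos : ∀ x, 0 < f x) :
    (∀ x ξ : UnitSphere n, ⟪(x : Ambient n), (ξ : Ambient n)⟫ = 0 →
      Integrable (criterionIntegrand f x ξ) volume) ∧
    ∀ u : UnitSphere n → ℝ, IsSphereSolution f u →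
      (IsConvexOnSphere u ↔ HessianFormNonneg u) ∧
      (IsConvexOnSphere u ↔
        ∀ x ξ : UnitSphere n, ⟪(x : Ambient n), (ξ : Ambient n)⟫ = 0 →
          0 ≤ 1 / sphereArea n * (∫ y, criterionIntegrand f x ξ y) + 1 / n * f x) := by
  have hn1 : 1 ≤ n := by omega
  refine ⟨fun x ξ hξ ↦ integrable_criterionIntegrand hn1 hα hfα hξ, fun u hu ↦ ?_⟩
  have h := isConvexOnSphere_iff_hessianFormNonneg hn hu.1
  refine ⟨h, h.trans ((hessianFormNonneg_iff_forall_unit u).trans ?_)⟩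
  refine forall_congr' fun x ↦ forall_congr' fun ξ ↦ forall_congr' fun hξ ↦ ?_
  rw [sphereHessian_add_eq hn1 hα hfα hu hξ]

end Criterion
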